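/- **Setting.** Let $\mathcal G$ be a second-countable, locally compact, Hausdorff étale groupoid with compact unit space $\mathcal G^{(0)}$, range and source maps $r,s$, and write $\mathcal G_u=\{\gamma : s(\gamma)=u\}$. Let $\ell:\mathcal G\to[0,\infty)$ be a proper continuous length function, i.e. $\ell$ is continuous, $\ell(\gamma)=0$ iff $\gamma\in\mathcal G^{(0)}$, $\ell(\gamma^{-1})=\ell(\gamma)$, $\ell(\gamma\mu)\le\ell(\gamma)+\ell(\mu)$ for composable $\gamma,\mu$, and every ball $B_\ell(t)=\{\gamma:\ell(\gamma)\le t\}$, $t\ge 0$, is compact. Let $d$ be a metric inducing the topology of $\mathcal G^{(0)}$, and let $\mathcal K=\{K_i\}_{i\in I}$ be a metric stratification of $\mathcal G$ with respect to $d$: $I$ is countable, the $K_i$ are open, precompact, pairwise disjoint and cover $\mathcal G$; for each $i$ the set $K_i^{-1}$ belongs to $\mathcal K$; $\mathcal G^{(0)}\in\mathcal K$; and for each $i$ the formula $d^{(i)}(\gamma,\mu)=\max\{d(s(\gamma),s(\mu)),d(r(\gamma),r(\mu))\}$ defines a totally bounded metric on $K_i$. Let $\mathcal E$ be the Hilbert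 $C(\mathcal G^{(0)})$-module obtained by completing $C_c(\mathcal G)$ for the inner product $\langle\xi,\eta\rangle(u)=\sum_{\mu\in\mathcal G_u}\overline{\xi(\mu)}\eta(\mu)$; let $\Lambda:C_c(\mathcal G)\to\mathcal L_{C(\mathcal G^{(0)})}(\mathcal E)$, $(\Lambda(f)\xi)(\gamma)=\sum_{\mu\in\mathcal G_{s(\gamma)}}f(\gamma\mu^{-1})\xi(\mu)$, be the left regular representation, and let $C_r^*(\mathcal G)$ be the norm closure of its range, so that $C_c(\mathcal G)\subseteq C_r^*(\mathcal G)$, with unit $1_{\mathcal G^{(0)}}$ and involution $f^*(\gamma)=\overline{f(\gamma^{-1})}$. Let $D_\ell$ be multiplication by $\ell$ on $C_c(\mathcal G)$ and let $\delta^n(f)\in\mathcal L_{C(\mathcal G^{(0)})}(\mathcal E)$ be the extension of the $n$-fold commutator $[D_\ell,[D_\ell,\dots,[D_\ell,\Lambda(f)]]]$. For $f\in C_c(\mathcal G)$ put $$L^{\mathcal K}_{\rm Lip}(f)=\sup_{i\in I}\ \sup_{\gamma\ne\mu\in K_i}\frac{|f(\gamma)-f(\mu)|}{d^{(i)}(\gamma,\mu)}\in[0,\infty],\qquad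 C_c^{\mathcal K,{\rm Lip}}(\mathcal G)=\{f\in C_c(\mathcal G): L^{\mathcal K}_{\rm Lip}(f)<\infty\},$$ and, for $n\ge1$ and $f\in C_c^{\mathcal K,{\rm Lip}}(\mathcal G)$, put $L^{\mathcal K,n}(f)=\max\{\|\delta^n(f)\|,L^{\mathcal K}_{\rm Lip}(f)\}$. An operator system is a unital $*$-invariant subspace $\mathcal X$ of a unital $C^*$-algebra; its state space $S(\mathcal X)$ consists of the positive unital functionals, with the weak$^*$ topology. A pair $(\mathcal X,L)$ is a compact quantum metric space if $L:\mathcal X\to[0,\infty)$ is a $*$-invariant seminorm vanishing on the scalars and the (extended) metric $\mathrm{mk}_L(\phi,\psi)=\sup\{|\phi(x)-\psi(x)|: L(x)\le1\}$ induces the weak$^*$ topology on $S(\mathcal X)$. **Lemma.** Let $\mathcal X\subseteq C_c^{\mathcal K,{\rm Lip}}(\mathcal G)$ be a sub-operator system (a $*$-invariant subspace containing $1_{\mathcal G^{(0)}}$) for which there is $t\ge0$ with $\mathrm{supp} f\subseteq B_\ell(t)$ for all $f\in\mathcal X$. Then $(\mathcal X,L^{\mathcal K,n}|_{\mathcal X})$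 is a compact quantum metric space for every integer $n\ge1$. In particular, if $\mathcal G$ is compact, then $(C_c^{\mathcal K,{\rm Lip}}(\mathcal G),L^{\mathcal K,n})$ is a compact quantum metric space for every integer $n\ge1$. -/

import Mathlib

open scoped ComplexOrder CompactlySupported InnerProductSpace ENNReal Topology

noncomputable section

/-! ### Completions of Hilbert modules and adjointable operators -/

namespace HilbertModule

open UniformSpace

section Completion

variable {A E : Type*} [CStarAlgebra A] [PartialOrder A] [StarOrderedRing A] [SMul A E]
  [NormedAddCommGroup E] [NormedSpace ℂ E] [CStarModule A E]

theorem inner_coe (x y : E) : ⟪(x : Completion E), (y : Completion E)⟫_A = ⟪x, y⟫_A :=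
  (Completion.isDenseInducing_coe.prodMap Completion.isDenseInducing_coe).extend_eq
    (CStarModule.continuous_inner (A := A) (E := E)) (x, y)

theorem continuous_inner_completion :
    Continuous fun p : Completion E × Completion E => ⟪p.1, p.2⟫_A := by
  let inner' : E →+ E →+ A :=
    { toFun := fun x => ((CStarModule.innerₛₗ : E →ₗ⋆[ℂ] E →ₗ[ℂ] A) x).toAddMonoidHom
      map_zero' := by ext y; simp
      map_add' := fun x y => by ext z; simp }
  have h : Continuous fun p : E × E => inner' p.1 p.2 :=
    CStarModule.continuous_inner (A := A) (E := E)
  exact (Completion.isDenseInducing_toCompl E).extend_Z_bilin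
    (Completion.isDenseInducing_toCompl E) h

variable [UniformContinuousConstSMul A E]

/-- The completion of a (pre-)Hilbert module over `A` is a Hilbert module over `A`: the inner
product and the module action are the continuous extensions. -/
instance completion : CStarModule A (Completion E) where
  inner_add_right {x y z} := by
    refine Completion.induction_on₃ x y z (isClosed_eq ?_ ?_) fun a b c => ?_
    · exact continuous_inner_completion.comp (by fun_prop :
        Continuous fun p : Completion E × Completion E × Completion E => (p.1, p.2.1 + p.2.2))
    · exact (continuous_inner_completion.comp (by fun_prop :
        Continuous fun p : Completion E × Completion E × Completion E => (p.1, p.2.1))).add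
        (continuous_inner_completion.comp (by fun_prop :
        Continuous fun p : Completion E × Completion E × Completion E => (p.1, p.2.2)))
    · simp only [← Completion.coe_add, inner_coe, CStarModule.inner_add_right]
  inner_self_nonneg {x} := by
    refine Completion.induction_on x (CStarAlgebra.isClosed_nonneg.preimage
      (continuous_inner_completion.comp (continuous_id.prodMk continuous_id))) fun a => ?_
    simpa only [inner_coe] using CStarModule.inner_self_nonneg
  inner_self {x} := by
    have h : ‖x‖ ^ 2 = ‖⟪x, x⟫_A‖ := by
      refine Completion.induction_on x (isClosed_eq (by fun_prop)
        (continuous_inner_completion.comp (continuous_id.prodMk continuous_id)).norm) fun a => ?_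
      simp only [inner_coe, Completion.norm_coe, CStarModule.norm_sq_eq A]
    rw [← norm_eq_zero, ← h]
    simp
  inner_op_smul_right {a x y} := by
    refine Completion.induction_on₂ x y (isClosed_eq ?_ ?_) fun b c => ?_
    · exact continuous_inner_completion.comp
        (continuous_fst.prodMk (continuous_snd.const_smul a))
    · exact continuous_const.mul continuous_inner_completion
    · rw [← Completion.coe_smul, inner_coe, inner_coe, CStarModule.inner_op_smul_right]
  inner_smul_right_complex {z x y} := by
    refine Completion.induction_on₂ x y (isClosed_eq ?_ ?_) fun b c => ?_
    · exact continuous_inner_completion.comp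
        (continuous_fst.prodMk (continuous_snd.const_smul z))
    · exact continuous_inner_completion.const_smul z
    · rw [← Completion.coe_smul, inner_coe, inner_coe, CStarModule.inner_smul_right_complex]
  star_inner x y := by
    refine Completion.induction_on₂ x y (isClosed_eq ?_ ?_) fun b c => ?_
    · exact continuous_inner_completion.star
    · exact continuous_inner_completion.comp (continuous_snd.prodMk continuous_fst)
    · rw [inner_coe, inner_coe, CStarModule.star_inner]
  norm_eq_sqrt_norm_inner_self x := by
    refine Completion.induction_on x (isClosed_eq (by fun_prop)
      (continuous_inner_completion.comp (continuous_id.prodMk continuous_id)).norm.sqrt)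
      fun a => ?_
    rw [inner_coe, Completion.norm_coe, CStarModule.norm_eq_sqrt_norm_inner_self (A := A)]

end Completion

section Adjointable

variable (A E : Type*) [CStarAlgebra A] [PartialOrder A] [SMul A E]
  [NormedAddCommGroup E] [NormedSpace ℂ E] [CStarModule A E]

/-- The algebra `𝓛_A(E)` of adjointable operators on a Hilbert module `E` over `A`, with the
operator norm. -/
def Adjointable : Subalgebra ℂ (E →L[ℂ] E) where
  carrier := {T | ∃ S : E →L[ℂ] E, ∀ x y : E, ⟪T x, y⟫_A = ⟪x, S y⟫_A}
  mul_mem' := by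
    rintro T T' ⟨S, h⟩ ⟨S', h'⟩
    exact ⟨S' * S, fun x y => by simp [h, h']⟩
  add_mem' := by
    rintro T T' ⟨S, h⟩ ⟨S', h'⟩
    exact ⟨S + S', fun x y => by simp [h, h']⟩
  algebraMap_mem' := by
    intro z
    refine ⟨algebraMap ℂ _ (star z), fun x y => ?_⟩
    simp [Algebra.algebraMap_eq_smul_one]

variable {A E}

theorem inner_ext {x y : E} (h : ∀ z : E, ⟪z, x⟫_A = ⟪z, y⟫_A) : x = y := by
  have := h (x - y)
  rw [← sub_eq_zero, ← CStarModule.inner_sub_right, CStarModule.inner_self] at this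
  exact sub_eq_zero.mp this

theorem adjoint_mem (T : Adjointable A E) : T.2.choose ∈ Adjointable A E := by
  refine ⟨T, fun x y => ?_⟩
  rw [← CStarModule.star_inner, ← T.2.choose_spec, CStarModule.star_inner]

/-- The adjoint of an adjointable operator. -/
instance : Star (Adjointable A E) := ⟨fun T => ⟨T.2.choose, adjoint_mem T⟩⟩

theorem inner_apply_left (T : Adjointable A E) (x y : E) :
    ⟪(T : E →L[ℂ] E) x, y⟫_A = ⟪x, ((star T : Adjointable A E) : E →L[ℂ] E) y⟫_A :=
  T.2.choose_spec x y

theorem inner_apply_right (T : Adjointable A E) (x y : E) :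
    ⟪x, (T : E →L[ℂ] E) y⟫_A = ⟪((star T : Adjointable A E) : E →L[ℂ] E) x, y⟫_A := by
  rw [← CStarModule.star_inner, inner_apply_left, CStarModule.star_inner]

theorem star_eq_of_inner {T S : Adjointable A E}
    (h : ∀ x y : E, ⟪(T : E →L[ℂ] E) x, y⟫_A = ⟪x, (S : E →L[ℂ] E) y⟫_A) : star T = S := by
  refine Subtype.ext (ContinuousLinearMap.ext fun y => inner_ext (A := A) fun x => ?_)
  rw [← inner_apply_left, h]

instance : StarRing (Adjointable A E) where
  star_involutive T := star_eq_of_inner fun x y => (inner_apply_right T x y).symm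
  star_mul S T := star_eq_of_inner fun x y => by
    simp [inner_apply_left]
  star_add S T := star_eq_of_inner fun x y => by
    simp [inner_apply_left]

instance : StarModule ℂ (Adjointable A E) where
  star_smul z T := star_eq_of_inner fun x y => by
    simp [inner_apply_left]

variable [StarOrderedRing A]

instance : CStarRing (Adjointable A E) where
  norm_mul_self_le T := by
    have h : ‖(T : E →L[ℂ] E)‖ ≤ √‖star T * T‖ := by
      refine ContinuousLinearMap.opNorm_le_bound _ (Real.sqrt_nonneg _) fun x => ?_
      refine (pow_le_pow_iff_left₀ (norm_nonneg _) (by positivity) two_ne_zero).mp ?_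
      calc ‖(T : E →L[ℂ] E) x‖ ^ 2 = ‖⟪x, ((star T * T : Adjointable A E) : E →L[ℂ] E) x⟫_A‖ := by
            rw [CStarModule.norm_sq_eq A, inner_apply_left]; rfl
        _ ≤ ‖x‖ * ‖((star T * T : Adjointable A E) : E →L[ℂ] E) x‖ := CStarModule.norm_inner_le E
        _ ≤ ‖x‖ * (‖((star T * T : Adjointable A E) : E →L[ℂ] E)‖ * ‖x‖) := by
            gcongr; exact ContinuousLinearMap.le_opNorm _ _
        _ = (√‖star T * T‖ * ‖x‖) ^ 2 := by
            have h0 : ‖((star T * T : Adjointable A E) : E →L[ℂ] E)‖ = √‖star T * T‖ ^ 2 :=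
              (Real.sq_sqrt (norm_nonneg (star T * T))).symm
            rw [h0]
            ring
    calc ‖T‖ * ‖T‖ ≤ √‖star T * T‖ * √‖star T * T‖ := mul_self_le_mul_self (norm_nonneg _) h
      _ = ‖star T * T‖ := Real.mul_self_sqrt (norm_nonneg _)

theorem isClosed_adjointable [CompleteSpace E] :
    IsClosed (Adjointable A E : Set (E →L[ℂ] E)) := by
  refine IsSeqClosed.isClosed fun u T hu hT => ?_
  let v : ℕ → Adjointable A E := fun n => ⟨u n, hu n⟩
  have hv : CauchySeq v := by
    have := hT.cauchySeq
    rw [Metric.cauchySeq_iff] at this ⊢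
    exact this
  have hw : CauchySeq fun n => star (v n) := by
    rw [Metric.cauchySeq_iff] at hv ⊢
    intro ε hε
    obtain ⟨N, hN⟩ := hv ε hε
    refine ⟨N, fun m hm n hn => ?_⟩
    have h1 := hN m hm n hn
    rw [dist_eq_norm] at h1 ⊢
    have h2 : star (v m) - star (v n) = star (v m - v n) := (star_sub (v m) (v n)).symm
    rw [h2]
    exact (norm_star (v m - v n)).trans_lt h1
  have hw' : CauchySeq fun n => ((star (v n) : Adjointable A E) : E →L[ℂ] E) := by
    rw [Metric.cauchySeq_iff] at hw ⊢
    exact hw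
  obtain ⟨S, hS⟩ := cauchySeq_tendsto_of_complete hw'
  refine ⟨S, fun x y => ?_⟩
  have h1 : Filter.Tendsto (fun n => ⟪u n x, y⟫_A) Filter.atTop (𝓝 ⟪T x, y⟫_A) :=
    (CStarModule.continuous_inner (A := A) (E := E)).continuousAt.tendsto.comp
      ((((ContinuousLinearMap.apply ℂ E x).continuous.tendsto T).comp hT).prodMk_nhds
        tendsto_const_nhds)
  have h2 : Filter.Tendsto (fun n => ⟪x, ((star (v n) : Adjointable A E) : E →L[ℂ] E) y⟫_A)
      Filter.atTop (𝓝 ⟪x, S y⟫_A) :=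
    (CStarModule.continuous_inner (A := A) (E := E)).continuousAt.tendsto.comp
      (tendsto_const_nhds.prodMk_nhds
        (((ContinuousLinearMap.apply ℂ E y).continuous.tendsto S).comp hS))
  refine tendsto_nhds_unique h1 (h2.congr fun n => ?_)
  exact (inner_apply_left (v n) x y).symm

/-- The adjointable operators on a complete Hilbert module form a unital C⋆-algebra. -/
instance [CompleteSpace E] : CStarAlgebra (Adjointable A E) where
  toCompleteSpace := isClosed_adjointable.completeSpace_coe

variable [UniformContinuousConstSMul A E]

/-- A bounded operator on a pre-Hilbert module with a formal adjoint extends to an adjointable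
operator on the completion. -/
def extendAdjointable (T S : E →L[ℂ] E) (h : ∀ x y : E, ⟪T x, y⟫_A = ⟪x, S y⟫_A) :
    Adjointable A (Completion E) :=
  ⟨T.completion, S.completion, fun x y => by
    refine Completion.induction_on₂ x y (isClosed_eq ?_ ?_) fun b c => ?_
    · exact continuous_inner_completion.comp
        ((T.completion.continuous.comp continuous_fst).prodMk continuous_snd)
    · exact continuous_inner_completion.comp
        (continuous_fst.prodMk (S.completion.continuous.comp continuous_snd))
    · simp [inner_coe, h]⟩

theorem extendAdjointable_coe (T S : E →L[ℂ] E) (h : ∀ x y : E, ⟪T x, y⟫_A = ⟪x, S y⟫_A) (x : E) :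
    (extendAdjointable T S h : Completion E →L[ℂ] Completion E) x = (T x : Completion E) := by
  simp [extendAdjointable]

theorem adjointable_ext {T S : Adjointable A (Completion E)}
    (h : ∀ x : E, (T : Completion E →L[ℂ] Completion E) x =
      (S : Completion E →L[ℂ] Completion E) x) : T = S := by
  refine Subtype.ext (ContinuousLinearMap.ext fun y => ?_)
  refine Completion.induction_on y (isClosed_eq ?_ ?_) h
  · exact ContinuousLinearMap.continuous _
  · exact ContinuousLinearMap.continuous _

end Adjointable

end HilbertModule

/-! ### Étale groupoids, length functions, metric stratifications -/

/-- A (topological) étale groupoid with space of arrows `G` and unit space `X`, the latter being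
identified with a subspace of `G` through `unit`. The product `mul γ μ` is the groupoid product
when `src γ = rng μ`; its values on other pairs are irrelevant and never used. -/
structure EtaleGroupoid (G X : Type*) [TopologicalSpace G] [TopologicalSpace X] where
  rng : G → X
  src : G → X
  unit : X → G
  inv : G → G
  mul : G → G → G
  rng_unit : ∀ u, rng (unit u) = u
  src_unit : ∀ u, src (unit u) = u
  rng_mul : ∀ γ μ, src γ = rng μ → rng (mul γ μ) = rng γ
  src_mul : ∀ γ μ, src γ = rng μ → src (mul γ μ) = src μ
  mul_assoc : ∀ γ μ ν, src γ = rng μ → src μ = rng ν → mul (mul γ μ) ν = mul γ (mul μ ν)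
  unit_mul : ∀ γ, mul (unit (rng γ)) γ = γ
  mul_unit : ∀ γ, mul γ (unit (src γ)) = γ
  rng_inv : ∀ γ, rng (inv γ) = src γ
  src_inv : ∀ γ, src (inv γ) = rng γ
  mul_inv : ∀ γ, mul γ (inv γ) = unit (rng γ)
  inv_mul : ∀ γ, mul (inv γ) γ = unit (src γ)
  continuous_unit : Continuous unit
  continuous_inv : Continuous inv
  continuousOn_mul : ContinuousOn (fun p : G × G => mul p.1 p.2) {p | src p.1 = rng p.2}
  isLocalHomeomorph_rng : IsLocalHomeomorph rng

namespace EtaleGroupoid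

section Basic

variable {G X : Type*} [TopologicalSpace G] [TopologicalSpace X] (𝒢 : EtaleGroupoid G X)

/-- A continuous length function on an étale groupoid. -/
structure LengthFunction where
  toFun : G → ℝ
  continuous_toFun : Continuous toFun
  nonneg : ∀ γ, 0 ≤ toFun γ
  eq_zero_iff : ∀ γ, toFun γ = 0 ↔ γ ∈ Set.range 𝒢.unit
  map_inv : ∀ γ, toFun (𝒢.inv γ) = toFun γ
  map_mul_le : ∀ γ μ, 𝒢.src γ = 𝒢.rng μ → toFun (𝒢.mul γ μ) ≤ toFun γ + toFun μ

instance : CoeFun 𝒢.LengthFunction (fun _ => G → ℝ) := ⟨LengthFunction.toFun⟩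

variable {𝒢} in
/-- The closed `ℓ`-ball of radius `t`. -/
def LengthFunction.ball (ℓ : 𝒢.LengthFunction) (t : ℝ) : Set G := {γ | ℓ γ ≤ t}

variable {𝒢} in
/-- A length function is proper if all its closed balls are compact. -/
def LengthFunction.IsProper (ℓ : 𝒢.LengthFunction) : Prop := ∀ t : ℝ, 0 ≤ t → IsCompact (ℓ.ball t)

theorem inv_inv (γ : G) : 𝒢.inv (𝒢.inv γ) = γ := by
  have h1 : 𝒢.mul (𝒢.inv (𝒢.inv γ)) (𝒢.mul (𝒢.inv γ) γ) = 𝒢.inv (𝒢.inv γ) := by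
    rw [𝒢.inv_mul]
    have := 𝒢.mul_unit (𝒢.inv (𝒢.inv γ))
    rwa [𝒢.src_inv, 𝒢.rng_inv] at this
  rw [← h1, ← 𝒢.mul_assoc _ _ _ (𝒢.src_inv _) (𝒢.src_inv _), 𝒢.inv_mul, 𝒢.src_inv, 𝒢.unit_mul]

theorem mul_inv_cancel_right {γ μ : G} (h : 𝒢.src γ = 𝒢.src μ) :
    𝒢.mul (𝒢.mul γ (𝒢.inv μ)) μ = γ := by
  rw [𝒢.mul_assoc _ _ _ (by rw [𝒢.rng_inv, h]) (𝒢.src_inv _), 𝒢.inv_mul, ← h, 𝒢.mul_unit]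

theorem inv_unit (u : X) : 𝒢.inv (𝒢.unit u) = 𝒢.unit u := by
  have h := 𝒢.unit_mul (𝒢.inv (𝒢.unit u))
  rw [𝒢.rng_inv, 𝒢.src_unit, 𝒢.mul_inv, 𝒢.rng_unit] at h
  exact h.symm

theorem inv_mul_inv {γ μ : G} (h : 𝒢.src γ = 𝒢.src μ) :
    𝒢.inv (𝒢.mul γ (𝒢.inv μ)) = 𝒢.mul μ (𝒢.inv γ) := by
  have hc : 𝒢.src γ = 𝒢.rng (𝒢.inv μ) := by rw [𝒢.rng_inv, h]
  have hc' : 𝒢.src μ = 𝒢.rng (𝒢.inv γ) := by rw [𝒢.rng_inv, h]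
  set a := 𝒢.mul γ (𝒢.inv μ) with ha
  set b := 𝒢.mul μ (𝒢.inv γ) with hb
  have hsa : 𝒢.src a = 𝒢.rng μ := by rw [ha, 𝒢.src_mul _ _ hc, 𝒢.src_inv]
  have hrb : 𝒢.rng b = 𝒢.rng μ := by rw [hb, 𝒢.rng_mul _ _ hc']
  have hra : 𝒢.rng a = 𝒢.rng γ := by rw [ha, 𝒢.rng_mul _ _ hc]
  have hab : 𝒢.mul a b = 𝒢.unit (𝒢.rng γ) := by
    rw [hb, ← 𝒢.mul_assoc _ _ _ hsa hc', ha, 𝒢.mul_inv_cancel_right h, 𝒢.mul_inv]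
  calc 𝒢.inv a = 𝒢.mul (𝒢.inv a) (𝒢.mul a b) := by
        have := 𝒢.mul_unit (𝒢.inv a)
        rw [𝒢.src_inv, hra] at this
        rw [hab, this]
    _ = b := by
        rw [← 𝒢.mul_assoc _ _ _ (𝒢.src_inv _) (hsa.trans hrb.symm), 𝒢.inv_mul, hsa, ← hrb,
          𝒢.unit_mul]

theorem LengthFunction.abs_sub_le (ℓ : 𝒢.LengthFunction) {γ μ : G} (h : 𝒢.src γ = 𝒢.src μ) :
    |ℓ γ - ℓ μ| ≤ ℓ (𝒢.mul γ (𝒢.inv μ)) := by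
  have h1 : ∀ {γ μ : G}, 𝒢.src γ = 𝒢.src μ → ℓ γ - ℓ μ ≤ ℓ (𝒢.mul γ (𝒢.inv μ)) := by
    intro γ μ h
    have hs : 𝒢.src (𝒢.mul γ (𝒢.inv μ)) = 𝒢.rng μ := by
      rw [𝒢.src_mul _ _ (by rw [𝒢.rng_inv, h]), 𝒢.src_inv]
    have := ℓ.map_mul_le _ _ hs
    rw [𝒢.mul_inv_cancel_right h] at this
    linarith
  rw [abs_le]
  refine ⟨?_, h1 h⟩
  have := h1 h.symm
  rw [← 𝒢.inv_mul_inv h, ℓ.map_inv] at this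
  linarith

theorem isLocalHomeomorph_src : IsLocalHomeomorph 𝒢.src := by
  have h : 𝒢.src = 𝒢.rng ∘ 𝒢.inv := funext fun γ => (𝒢.rng_inv γ).symm
  rw [h]
  exact 𝒢.isLocalHomeomorph_rng.comp (Homeomorph.isLocalHomeomorph
    ⟨⟨𝒢.inv, 𝒢.inv, 𝒢.inv_inv, 𝒢.inv_inv⟩, 𝒢.continuous_inv, 𝒢.continuous_inv⟩)

theorem continuous_src : Continuous 𝒢.src := 𝒢.isLocalHomeomorph_src.continuous

theorem continuous_rng : Continuous 𝒢.rng := 𝒢.isLocalHomeomorph_rng.continuous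

theorem isOpen_range_unit : IsOpen (Set.range 𝒢.unit) := by
  rw [isOpen_iff_forall_mem_open]
  rintro _ ⟨u, rfl⟩
  obtain ⟨U, hU, hu, hinj⟩ := 𝒢.isLocalHomeomorph_src.isLocallyInjective (𝒢.unit u)
  refine ⟨U ∩ (fun γ => 𝒢.unit (𝒢.src γ)) ⁻¹' U, ?_,
    hU.inter (hU.preimage (𝒢.continuous_unit.comp 𝒢.continuous_src)), hu, ?_⟩
  · rintro γ ⟨h1, h2⟩
    exact ⟨𝒢.src γ, hinj h2 h1 (𝒢.src_unit _)⟩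
  · simpa [𝒢.src_unit] using hu

/-- The arrows with source `u`. -/
def srcFiber (u : X) : Set G := {γ | 𝒢.src γ = u}

end Basic

/-! ### Sums over fibers -/

section FiberSum

variable {Y Z : Type*} [TopologicalSpace Y]

theorem exists_card_le {p : Y → Z} (hp : IsLocallyInjective p) {K : Set Y} (hK : IsCompact K) :
    ∃ N : ℕ, ∀ z, ∀ S : Finset Y, (∀ y ∈ S, y ∈ K ∧ p y = z) → S.card ≤ N := by
  classical
  refine hK.induction_on (p := fun K => ∃ N : ℕ, ∀ z, ∀ S : Finset Y,
    (∀ y ∈ S, y ∈ K ∧ p y = z) → S.card ≤ N) ?_ ?_ ?_ ?_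
  · refine ⟨0, fun z S hS => ?_⟩
    rw [Nat.le_zero, Finset.card_eq_zero, Finset.eq_empty_iff_forall_notMem]
    exact fun y hy => (hS y hy).1
  · rintro K L hKL ⟨N, hN⟩
    exact ⟨N, fun z S hS => hN z S fun y hy => ⟨hKL (hS y hy).1, (hS y hy).2⟩⟩
  · rintro K L ⟨N, hN⟩ ⟨M, hM⟩
    refine ⟨N + M, fun z S hS => ?_⟩
    rw [← Finset.card_filter_add_card_filter_not (s := S) (· ∈ K)]
    refine add_le_add (hN z _ fun y hy => ?_) (hM z _ fun y hy => ?_)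
    · rw [Finset.mem_filter] at hy
      exact ⟨hy.2, (hS y hy.1).2⟩
    · rw [Finset.mem_filter] at hy
      exact ⟨(hS y hy.1).1.resolve_left hy.2, (hS y hy.1).2⟩
  · intro x _
    obtain ⟨U, hU, hx, hinj⟩ := hp x
    refine ⟨U, mem_nhdsWithin_of_mem_nhds (hU.mem_nhds hx), 1, fun z S hS => ?_⟩
    rw [Finset.card_le_one]
    exact fun a ha b hb => hinj (hS a ha).1 (hS b hb).1 ((hS a ha).2.trans (hS b hb).2.symm)

theorem finite_inter_fiber {p : Y → Z} (hp : IsLocallyInjective p) {K : Set Y} (hK : IsCompact K)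
    (z : Z) : (K ∩ {y | p y = z}).Finite := by
  obtain ⟨N, hN⟩ := exists_card_le hp hK
  by_contra h
  obtain ⟨S, hS, hc⟩ := Set.Infinite.exists_subset_card_eq h (N + 1)
  have := hN z S fun y hy => hS hy
  omega

variable [TopologicalSpace Z]

theorem continuous_fiberSum [T2Space Y] [T2Space Z] {p : Y → Z} (hp : IsLocalHomeomorph p)
    {F : Y → ℂ} (hF : Continuous F) (hFc : HasCompactSupport F) :
    Continuous fun z => ∑ᶠ y ∈ {y | p y = z}, F y := by
  classical
  rw [continuous_iff_continuousAt]
  intro z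
  have hfin := finite_inter_fiber hp.isLocallyInjective hFc z
  set T := hfin.toFinset with hT
  choose e he hpe using hp
  obtain ⟨U, hU, hdisj⟩ := hfin.t2_separation
  let V : Y → Set Y := fun y => U y ∩ (e y).source
  have hVo : ∀ y, IsOpen (V y) := fun y => (hU y).2.inter (e y).open_source
  have hyV : ∀ y, y ∈ V y := fun y => ⟨(hU y).1, he y⟩
  have hVdisj : ∀ y ∈ T, ∀ y' ∈ T, y ≠ y' → Disjoint (V y) (V y') := fun y hy y' hy' h =>
    (hdisj (hfin.mem_toFinset.mp hy) (hfin.mem_toFinset.mp hy') h).mono Set.inter_subset_left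
      Set.inter_subset_left
  have hpc : Continuous p := by
    rw [continuous_iff_continuousAt]
    intro y
    rw [hpe y]
    exact (e y).continuousAt (he y)
  let R := tsupport F \ ⋃ y ∈ T, V y
  have hR : IsCompact R := hFc.isCompact.diff (isOpen_biUnion fun y _ => hVo y)
  have hzR : z ∉ p '' R := by
    rintro ⟨y, ⟨hy1, hy2⟩, hy3⟩
    exact hy2 (Set.mem_biUnion (hfin.mem_toFinset.mpr ⟨hy1, hy3⟩) (hyV y))
  let W : Set Z := (p '' R)ᶜ ∩ ⋂ y ∈ T, (e y) '' (V y)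
  have hWo : IsOpen W := by
    refine (hR.image hpc).isClosed.isOpen_compl.inter (isOpen_biInter_finset fun y _ => ?_)
    exact (e y).isOpen_image_of_subset_source (hVo y) Set.inter_subset_right
  have hpT : ∀ y ∈ T, p y = z := fun y hy => (hfin.mem_toFinset.mp hy).2
  have hzW : z ∈ W := by
    refine ⟨hzR, Set.mem_iInter₂.mpr fun y hy => ⟨y, hyV y, ?_⟩⟩
    rw [← hpe y]
    exact hpT y hy
  have key : ∀ w ∈ W, ∑ᶠ y ∈ {y | p y = w}, F y = ∑ y ∈ T, F ((e y).symm w) := by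
    rintro w ⟨hw1, hw2⟩
    have hV : ∀ y ∈ T, (e y).symm w ∈ V y ∧ p ((e y).symm w) = w := by
      intro y hy
      obtain ⟨v, hv, rfl⟩ := Set.mem_iInter₂.mp hw2 y hy
      rw [(e y).left_inv hv.2]
      exact ⟨hv, by rw [← hpe y]⟩
    have hinj : Set.InjOn (fun y => (e y).symm w) T := by
      intro y hy y' hy' h
      by_contra hne
      have h' : (e y).symm w = (e y').symm w := h
      exact Set.disjoint_left.mp (hVdisj y hy y' hy' hne) (hV y hy).1 (h' ▸ (hV y' hy').1)
    rw [← Finset.sum_image hinj]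
    refine finsum_mem_eq_sum_of_inter_support_eq _ ?_
    ext v
    simp only [Set.mem_inter_iff, Set.mem_ofPred_eq, Function.mem_support, Finset.coe_image,
      Set.mem_image, Finset.mem_coe]
    constructor
    · rintro ⟨hv, hFv⟩
      refine ⟨?_, hFv⟩
      have : v ∈ ⋃ y ∈ T, V y := by
        by_contra hcon
        exact hw1 ⟨v, ⟨subset_tsupport _ hFv, hcon⟩, hv⟩
      obtain ⟨y, hy, hvy⟩ := Set.mem_iUnion₂.mp this
      refine ⟨y, hy, ?_⟩
      rw [← hv, hpe y, (e y).left_inv hvy.2]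
    · rintro ⟨⟨y, hy, rfl⟩, hFv⟩
      exact ⟨(hV y hy).2, hFv⟩
  have hc : ContinuousAt (fun w => ∑ y ∈ T, F ((e y).symm w)) z := by
    refine tendsto_finsetSum _ fun y hy => ?_
    have hz : z ∈ (e y).target := by
      rw [← hpT y hy, hpe y]
      exact (e y).map_source (he y)
    exact hF.continuousAt.comp ((e y).continuousAt_symm hz)
  exact hc.congr (Filter.eventually_of_mem (hWo.mem_nhds hzW) fun w hw => (key w hw).symm)

end FiberSum

end EtaleGroupoid

namespace EtaleGroupoid

section Module

variable {G X : Type*} [TopologicalSpace G] [TopologicalSpace X] (𝒢 : EtaleGroupoid G X)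

theorem finsum_fiber_eq {M : Type*} [AddCommMonoid M] {u : X} {g : G → M} {S : Finset G}
    (h1 : ∀ γ ∈ S, 𝒢.src γ = u) (h2 : ∀ γ, 𝒢.src γ = u → g γ ≠ 0 → γ ∈ S) :
    ∑ᶠ γ ∈ 𝒢.srcFiber u, g γ = ∑ γ ∈ S, g γ := by
  refine finsum_mem_eq_sum_of_inter_support_eq _ ?_
  ext γ
  exact ⟨fun h => ⟨h2 γ h.1 h.2, h.2⟩, fun h => ⟨h1 γ h.1, h.2⟩⟩

theorem finite_support_fiber (ξ : C_c(G, ℂ)) (u : X) :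
    {γ | 𝒢.src γ = u ∧ ξ γ ≠ 0}.Finite :=
  (finite_inter_fiber 𝒢.isLocalHomeomorph_src.isLocallyInjective ξ.hasCompactSupport u).subset
    fun _ h => ⟨subset_tsupport _ h.2, h.1⟩

/-- The space `C_c(G)`, regarded as a pre-Hilbert module over `C(X)`. -/
def PreModule (_ : EtaleGroupoid G X) : Type _ := C_c(G, ℂ)

instance : AddCommGroup 𝒢.PreModule := inferInstanceAs (AddCommGroup C_c(G, ℂ))
instance : Module ℂ 𝒢.PreModule := inferInstanceAs (Module ℂ C_c(G, ℂ))
instance : FunLike 𝒢.PreModule G ℂ := inferInstanceAs (FunLike C_c(G, ℂ) G ℂ)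

variable {𝒢} in
/-- A function in `C_c(G)`, regarded as a vector of the pre-Hilbert module. -/
def PreModule.of (f : C_c(G, ℂ)) : 𝒢.PreModule := f

variable {𝒢} in
theorem PreModule.of_apply (f : C_c(G, ℂ)) (γ : G) : (PreModule.of f : 𝒢.PreModule) γ = f γ := rfl

variable {𝒢} in
theorem PreModule.add_apply (ξ η : 𝒢.PreModule) (γ : G) : (ξ + η) γ = ξ γ + η γ := rfl

variable {𝒢} in
theorem PreModule.smul_apply (z : ℂ) (ξ : 𝒢.PreModule) (γ : G) : (z • ξ) γ = z * ξ γ := rfl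

variable {𝒢} in
theorem PreModule.ext {ξ η : 𝒢.PreModule} (h : ∀ γ, ξ γ = η γ) : ξ = η := DFunLike.ext _ _ h

/-- The right action `(ξ · f)(γ) = ξ(γ) f(s(γ))` of `C(X)` on `C_c(G)`. -/
instance : SMul C(X, ℂ) 𝒢.PreModule where
  smul f ξ := (⟨⟨fun γ => ξ γ * f (𝒢.src γ), (map_continuous (show C_c(G, ℂ) from ξ)).mul
    (f.continuous.comp 𝒢.continuous_src)⟩,
      (show C_c(G, ℂ) from ξ).hasCompactSupport.mul_right⟩ : C_c(G, ℂ))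

variable {𝒢} in
theorem exists_finset (ξ : 𝒢.PreModule) (u : X) :
    ∃ S : Finset G, (∀ γ ∈ S, 𝒢.src γ = u) ∧ ∀ γ, 𝒢.src γ = u → ξ γ ≠ 0 → γ ∈ S :=
  ⟨(𝒢.finite_support_fiber ξ u).toFinset, fun _ h => ((Set.Finite.mem_toFinset _).mp h).1,
    fun _ h h' => (Set.Finite.mem_toFinset _).mpr ⟨h, h'⟩⟩

variable [T2Space G] [T2Space X]

/-- The inner product `⟪ξ, η⟫(u) = ∑_{μ ∈ G_u} conj (ξ μ) η μ`, with values in `C(X)`. -/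
instance : Inner C(X, ℂ) 𝒢.PreModule where
  inner ξ η := ⟨fun u => ∑ᶠ μ ∈ 𝒢.srcFiber u, star (ξ μ) * η μ,
    continuous_fiberSum 𝒢.isLocalHomeomorph_src
      ((map_continuous (show C_c(G, ℂ) from ξ)).star.mul
        (map_continuous (show C_c(G, ℂ) from η)))
      (show C_c(G, ℂ) from η).hasCompactSupport.mul_left⟩

variable {𝒢} in
theorem inner_apply (ξ η : 𝒢.PreModule) (u : X) :
    (⟪ξ, η⟫_C(X, ℂ)) u = ∑ᶠ μ ∈ 𝒢.srcFiber u, star (ξ μ) * η μ := rfl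

variable {𝒢} in
theorem inner_eq_sum (ξ η : 𝒢.PreModule) {u : X} {S : Finset G} (h1 : ∀ γ ∈ S, 𝒢.src γ = u)
    (h2 : ∀ γ, 𝒢.src γ = u → η γ ≠ 0 → γ ∈ S) :
    (⟪ξ, η⟫_C(X, ℂ)) u = ∑ γ ∈ S, star (ξ γ) * η γ :=
  𝒢.finsum_fiber_eq h1 fun γ h h' => h2 γ h fun h0 => h' (by rw [h0, mul_zero])

variable {𝒢} in
theorem inner_eq_sum_left (ξ η : 𝒢.PreModule) {u : X} {S : Finset G} (h1 : ∀ γ ∈ S, 𝒢.src γ = u)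
    (h2 : ∀ γ, 𝒢.src γ = u → ξ γ ≠ 0 → γ ∈ S) :
    (⟪ξ, η⟫_C(X, ℂ)) u = ∑ γ ∈ S, star (ξ γ) * η γ :=
  𝒢.finsum_fiber_eq h1 fun γ h h' => h2 γ h fun h0 => h' (by rw [h0, star_zero, zero_mul])

variable {𝒢} in
theorem inner_self_eq_sum (ξ : 𝒢.PreModule) {u : X} {S : Finset G} (h1 : ∀ γ ∈ S, 𝒢.src γ = u)
    (h2 : ∀ γ, 𝒢.src γ = u → ξ γ ≠ 0 → γ ∈ S) :
    (⟪ξ, ξ⟫_C(X, ℂ)) u = ((∑ γ ∈ S, ‖ξ γ‖ ^ 2 : ℝ) : ℂ) := by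
  rw [inner_eq_sum ξ ξ h1 h2, Complex.ofReal_sum]
  refine Finset.sum_congr rfl fun γ _ => ?_
  rw [Complex.ofReal_pow, ← Complex.conj_mul']
  rfl

variable [CompactSpace X]

/-- The norm `‖ξ‖ = ‖⟪ξ, ξ⟫‖ ^ (1/2)` on `C_c(G)`. -/
instance : Norm 𝒢.PreModule := CStarModule.norm C(X, ℂ)

instance : CStarModule C(X, ℂ) 𝒢.PreModule where
  inner_add_right {ξ η ζ} := by
    classical
    ext u
    obtain ⟨S, h1, h2⟩ := exists_finset ξ u
    rw [ContinuousMap.add_apply, inner_eq_sum_left ξ _ h1 h2, inner_eq_sum_left ξ _ h1 h2,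
      inner_eq_sum_left ξ _ h1 h2, ← Finset.sum_add_distrib]
    simp only [PreModule.add_apply, mul_add]
  inner_self_nonneg {ξ} := by
    rw [ContinuousMap.le_def]
    intro u
    obtain ⟨S, h1, h2⟩ := exists_finset ξ u
    rw [inner_self_eq_sum ξ h1 h2]
    exact Complex.zero_le_real.mpr (by positivity)
  inner_self {ξ} := by
    constructor
    · intro h
      refine PreModule.ext fun γ => ?_
      by_contra hγ
      obtain ⟨S, h1, h2⟩ := exists_finset ξ (𝒢.src γ)
      have h3 := inner_self_eq_sum ξ h1 h2
      rw [h, ContinuousMap.zero_apply, eq_comm, Complex.ofReal_eq_zero,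
        Finset.sum_eq_zero_iff_of_nonneg (fun _ _ => by positivity)] at h3
      exact hγ (norm_eq_zero.mp (pow_eq_zero_iff two_ne_zero |>.mp (h3 γ (h2 γ rfl hγ))))
    · rintro rfl
      ext u
      rw [inner_eq_sum (S := ∅) _ _ (by simp) (fun γ _ h => (h rfl).elim)]
      simp
  inner_op_smul_right {f ξ η} := by
    ext u
    obtain ⟨S, h1, h2⟩ := exists_finset ξ u
    rw [ContinuousMap.mul_apply, inner_eq_sum_left ξ _ h1 h2, inner_eq_sum_left ξ _ h1 h2,
      Finset.mul_sum]
    refine Finset.sum_congr rfl fun γ hγ => ?_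
    change _ * (η γ * f (𝒢.src γ)) = _
    rw [h1 γ hγ]
    ring
  inner_smul_right_complex {z ξ η} := by
    ext u
    obtain ⟨S, h1, h2⟩ := exists_finset ξ u
    rw [ContinuousMap.smul_apply, inner_eq_sum_left ξ _ h1 h2, inner_eq_sum_left ξ _ h1 h2,
      smul_eq_mul, Finset.mul_sum]
    refine Finset.sum_congr rfl fun γ hγ => ?_
    rw [PreModule.smul_apply]
    ring
  star_inner ξ η := by
    ext u
    obtain ⟨S, h1, h2⟩ := exists_finset ξ u
    rw [ContinuousMap.star_apply, inner_eq_sum_left ξ _ h1 h2, inner_eq_sum η _ h1 h2, star_sum]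
    refine Finset.sum_congr rfl fun γ hγ => ?_
    rw [star_mul', star_star, mul_comm]
  norm_eq_sqrt_norm_inner_self ξ := rfl

instance : NormedAddCommGroup 𝒢.PreModule := CStarModule.normedAddCommGroup C(X, ℂ)
instance : NormedSpace ℂ 𝒢.PreModule := .ofCore (CStarModule.normedSpaceCore C(X, ℂ))

theorem norm_le_iff (ξ : 𝒢.PreModule) {c : ℝ} (hc : 0 ≤ c) :
    ‖ξ‖ ≤ c ↔ ∀ u, ∀ S : Finset G, (∀ γ ∈ S, 𝒢.src γ = u) → ∑ γ ∈ S, ‖ξ γ‖ ^ 2 ≤ c ^ 2 := by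
  classical
  rw [← pow_le_pow_iff_left₀ (norm_nonneg ξ) hc two_ne_zero, CStarModule.norm_sq_eq C(X, ℂ),
    ContinuousMap.norm_le _ (sq_nonneg c)]
  refine forall_congr' fun u => ?_
  obtain ⟨S, h1, h2⟩ := exists_finset ξ u
  rw [inner_self_eq_sum ξ h1 h2, Complex.norm_real, Real.norm_of_nonneg (by positivity)]
  refine ⟨fun h T hT => le_trans ?_ h, fun h => h S h1⟩
  have : ∑ γ ∈ T, ‖ξ γ‖ ^ 2 = ∑ γ ∈ T with ξ γ ≠ 0, ‖ξ γ‖ ^ 2 := by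
    rw [Finset.sum_filter_of_ne]
    intro γ _ h h0
    exact h (by rw [h0]; simp)
  rw [this]
  refine Finset.sum_le_sum_of_subset_of_nonneg (fun γ hγ => ?_) fun _ _ _ => by positivity
  rw [Finset.mem_filter] at hγ
  exact h2 γ (hT γ hγ.1) hγ.2

instance : UniformContinuousConstSMul C(X, ℂ) 𝒢.PreModule where
  uniformContinuous_const_smul f := by
    refine LipschitzWith.uniformContinuous (K := ‖f‖₊) (LipschitzWith.of_dist_le_mul fun ξ η => ?_)
    have hsub : f • ξ - f • η = f • (ξ - η) := PreModule.ext fun γ =>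
      (sub_mul (ξ γ) (η γ) (f (𝒢.src γ))).symm
    rw [dist_eq_norm, dist_eq_norm, hsub, coe_nnnorm]
    set ζ := ξ - η
    rw [norm_le_iff _ _ (by positivity)]
    intro u S hS
    have hζ := (𝒢.norm_le_iff ζ (norm_nonneg ζ)).mp le_rfl u S hS
    calc ∑ γ ∈ S, ‖(f • ζ) γ‖ ^ 2 ≤ ∑ γ ∈ S, ‖f‖ ^ 2 * ‖ζ γ‖ ^ 2 := by
          refine Finset.sum_le_sum fun γ _ => ?_
          change ‖ζ γ * f (𝒢.src γ)‖ ^ 2 ≤ _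
          rw [norm_mul, mul_pow, mul_comm]
          gcongr
          exact f.norm_coe_le_norm _
      _ = ‖f‖ ^ 2 * ∑ γ ∈ S, ‖ζ γ‖ ^ 2 := by rw [Finset.mul_sum]
      _ ≤ (‖f‖ * ‖ζ‖) ^ 2 := by
          rw [mul_pow]
          gcongr

/-- The Hilbert `C(X)`-module `ℰ`, the completion of `C_c(G)`. -/
abbrev HilbertMod : Type _ := UniformSpace.Completion 𝒢.PreModule

end Module

end EtaleGroupoid

namespace EtaleGroupoid

section Convolution

variable {G X : Type*} [TopologicalSpace G] [TopologicalSpace X] (𝒢 : EtaleGroupoid G X)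

theorem isLocalHomeomorph_pullback :
    IsLocalHomeomorph fun p : {p : G × G // 𝒢.src p.1 = 𝒢.src p.2} => p.1.1 := by
  intro y
  classical
  obtain ⟨e, he, hse'⟩ := 𝒢.isLocalHomeomorph_src y.1.2
  have hse : ∀ x, 𝒢.src x = e x := congrFun hse'
  clear hse'
  refine ⟨{ toFun := fun p => p.1.1
            invFun := fun γ => if h : 𝒢.src γ ∈ e.target then
              ⟨(γ, e.symm (𝒢.src γ)), by
                change 𝒢.src γ = 𝒢.src (e.symm (𝒢.src γ))
                rw [hse (e.symm _), e.right_inv h]⟩ else y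
            source := {p | p.1.2 ∈ e.source}
            target := 𝒢.src ⁻¹' e.target
            map_source' := ?_
            map_target' := ?_
            left_inv' := ?_
            right_inv' := ?_
            open_source := ?_
            open_target := e.open_target.preimage 𝒢.continuous_src
            continuousOn_toFun := (continuous_fst.comp continuous_subtype_val).continuousOn
            continuousOn_invFun := ?_ }, he, rfl⟩
  · intro p hp
    change 𝒢.src p.1.1 ∈ e.target
    rw [p.2, hse]
    exact e.map_source hp
  · intro γ hγ
    have hγ' : 𝒢.src γ ∈ e.target := hγ
    simp only [dif_pos hγ']
    exact e.map_target hγ'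
  · intro p hp
    have hp' : 𝒢.src p.1.1 ∈ e.target := by
      rw [p.2, hse]
      exact e.map_source hp
    simp only [dif_pos hp']
    refine Subtype.ext (Prod.ext rfl ?_)
    change e.symm (𝒢.src p.1.1) = p.1.2
    rw [p.2, hse]
    exact e.left_inv hp
  · intro γ hγ
    have hγ' : 𝒢.src γ ∈ e.target := hγ
    simp only [dif_pos hγ']
  · have hind : Topology.IsInducing
        (Subtype.val : {p : G × G // 𝒢.src p.1 = 𝒢.src p.2} → G × G) := ⟨rfl⟩
    rw [hind.continuousOn_iff]
    have h : ContinuousOn (fun γ => (γ, e.symm (𝒢.src γ))) (𝒢.src ⁻¹' e.target) :=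
      continuousOn_id.prodMk (e.continuousOn_symm.comp 𝒢.continuous_src.continuousOn fun _ h => h)
    refine h.congr fun γ hγ => ?_
    have hγ' : 𝒢.src γ ∈ e.target := hγ
    simp only [Function.comp_apply, dif_pos hγ']
  · exact e.open_source.preimage (continuous_snd.comp continuous_subtype_val)

theorem isCompact_mul [T2Space X] {K L : Set G} (hK : IsCompact K) (hL : IsCompact L) :
    IsCompact ((fun p : G × G => 𝒢.mul p.1 p.2) ''
      ((K ×ˢ L) ∩ {p | 𝒢.src p.1 = 𝒢.rng p.2})) := by
  refine IsCompact.image_of_continuousOn ((hK.prod hL).inter_right ?_)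
    (𝒢.continuousOn_mul.mono Set.inter_subset_right)
  exact isClosed_eq (𝒢.continuous_src.comp continuous_fst) (𝒢.continuous_rng.comp continuous_snd)

theorem mem_mul {K L : Set G} {γ μ : G} (h : 𝒢.src γ = 𝒢.src μ) (hK : 𝒢.mul γ (𝒢.inv μ) ∈ K)
    (hL : μ ∈ L) : γ ∈ (fun p : G × G => 𝒢.mul p.1 p.2) ''
      ((K ×ˢ L) ∩ {p | 𝒢.src p.1 = 𝒢.rng p.2}) :=
  ⟨(𝒢.mul γ (𝒢.inv μ), μ), ⟨⟨hK, hL⟩, by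
    change 𝒢.src _ = _
    rw [𝒢.src_mul _ _ (by rw [𝒢.rng_inv, h]), 𝒢.src_inv]⟩, 𝒢.mul_inv_cancel_right h⟩

variable {𝒢} in
theorem kernel_eq_sum (k : G → ℂ) (ξ : 𝒢.PreModule) {u : X} {S : Finset G}
    (h1 : ∀ γ ∈ S, 𝒢.src γ = u) (h2 : ∀ γ, 𝒢.src γ = u → ξ γ ≠ 0 → γ ∈ S) :
    ∑ᶠ μ ∈ 𝒢.srcFiber u, k μ * ξ μ = ∑ μ ∈ S, k μ * ξ μ :=
  𝒢.finsum_fiber_eq h1 fun γ h h' => h2 γ h fun h0 => h' (by rw [h0, mul_zero])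

/-- The operator `D_ℓ` of multiplication by the length function, on its domain `C_c(G)`. -/
def lengthOp (ℓ : 𝒢.LengthFunction) : 𝒢.PreModule →ₗ[ℂ] 𝒢.PreModule where
  toFun ξ := (⟨⟨fun γ => (ℓ γ : ℂ) * ξ γ,
    (Complex.continuous_ofReal.comp ℓ.continuous_toFun).mul
      (map_continuous (show C_c(G, ℂ) from ξ))⟩,
    (show C_c(G, ℂ) from ξ).hasCompactSupport.mul_left⟩ : C_c(G, ℂ))
  map_add' _ _ := PreModule.ext fun _ => mul_add _ _ _
  map_smul' _ _ := PreModule.ext fun _ => mul_left_comm _ _ _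

theorem lengthOp_apply (ℓ : 𝒢.LengthFunction) (ξ : 𝒢.PreModule) (γ : G) :
    𝒢.lengthOp ℓ ξ γ = ℓ γ * ξ γ := rfl

variable [T2Space G]

/-- The involution `f^*(γ) = conj (f(γ⁻¹))` of `C_c(G)`. -/
def invol (f : C_c(G, ℂ)) : C_c(G, ℂ) :=
  ⟨⟨fun γ => star (f (𝒢.inv γ)), ((map_continuous f).comp 𝒢.continuous_inv).star⟩, by
    refine HasCompactSupport.intro (K := 𝒢.inv ⁻¹' tsupport f) ?_ fun γ hγ => ?_
    · let i : G ≃ₜ G :=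
        ⟨⟨𝒢.inv, 𝒢.inv, 𝒢.inv_inv, 𝒢.inv_inv⟩, 𝒢.continuous_inv, 𝒢.continuous_inv⟩
      exact i.isCompact_preimage.mpr f.hasCompactSupport
    · change star (f (𝒢.inv γ)) = 0
      rw [image_eq_zero_of_notMem_tsupport hγ, star_zero]⟩

theorem invol_apply (f : C_c(G, ℂ)) (γ : G) : 𝒢.invol f γ = star (f (𝒢.inv γ)) := rfl

/-- The unit `1_{G⁽⁰⁾}` of the convolution algebra `C_c(G)`. -/
def one [CompactSpace X] : C_c(G, ℂ) :=
  ⟨⟨Set.indicator (Set.range 𝒢.unit) 1, by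
    refine IsClopen.continuous_indicator ⟨?_, 𝒢.isOpen_range_unit⟩ continuous_one
    exact (isCompact_range 𝒢.continuous_unit).isClosed⟩,
    HasCompactSupport.intro (isCompact_range 𝒢.continuous_unit) fun _ h =>
      Set.indicator_of_notMem h _⟩

theorem one_apply_unit [CompactSpace X] (u : X) : 𝒢.one (𝒢.unit u) = 1 :=
  Set.indicator_of_mem (Set.mem_range_self u) _

theorem one_apply_of_notMem [CompactSpace X] {γ : G} (h : γ ∉ Set.range 𝒢.unit) : 𝒢.one γ = 0 :=
  Set.indicator_of_notMem h _

variable [T2Space X]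

/-- The convolution `(f * ξ)(γ) = ∑_{μ ∈ G_{s(γ)}} f(γ μ⁻¹) ξ(μ)`. -/
def convFun (f ξ : G → ℂ) (γ : G) : ℂ :=
  ∑ᶠ μ ∈ 𝒢.srcFiber (𝒢.src γ), f (𝒢.mul γ (𝒢.inv μ)) * ξ μ

theorem continuous_convFun (f ξ : C_c(G, ℂ)) : Continuous (𝒢.convFun f ξ) := by
  classical
  let Y := {p : G × G // 𝒢.src p.1 = 𝒢.src p.2}
  let F : Y → ℂ := fun p => f (𝒢.mul p.1.1 (𝒢.inv p.1.2)) * ξ p.1.2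
  have hmul : Continuous fun p : Y => 𝒢.mul p.1.1 (𝒢.inv p.1.2) := by
    refine 𝒢.continuousOn_mul.comp_continuous (f := fun p : Y => (p.1.1, 𝒢.inv p.1.2)) ?_ ?_
    · exact (continuous_fst.comp continuous_subtype_val).prodMk
        (𝒢.continuous_inv.comp (continuous_snd.comp continuous_subtype_val))
    · intro p
      change 𝒢.src _ = 𝒢.rng _
      rw [𝒢.rng_inv]
      exact p.2
  have hF : Continuous F := ((map_continuous f).comp hmul).mul
    ((map_continuous ξ).comp (continuous_snd.comp continuous_subtype_val))
  have hFc : HasCompactSupport F := by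
    have hC := 𝒢.isCompact_mul f.hasCompactSupport.isCompact ξ.hasCompactSupport.isCompact
    have hcl : Topology.IsClosedEmbedding (Subtype.val : Y → G × G) :=
      (isClosed_eq (𝒢.continuous_src.comp continuous_fst)
        (𝒢.continuous_src.comp continuous_snd)).isClosedEmbedding_subtypeVal
    refine HasCompactSupport.intro
      (hcl.isCompact_preimage (hC.prod ξ.hasCompactSupport.isCompact)) fun p hp => ?_
    by_contra h0
    have h1 : f (𝒢.mul p.1.1 (𝒢.inv p.1.2)) ≠ 0 := left_ne_zero_of_mul h0
    have h2 : ξ p.1.2 ≠ 0 := right_ne_zero_of_mul h0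
    exact hp ⟨𝒢.mem_mul p.2 (subset_tsupport _ h1) (subset_tsupport _ h2), subset_tsupport _ h2⟩
  have h := continuous_fiberSum 𝒢.isLocalHomeomorph_pullback hF hFc
  refine h.congr fun γ => ?_
  symm
  refine finsum_mem_eq_of_bijOn (fun μ => if hμ : 𝒢.src γ = 𝒢.src μ then ⟨(γ, μ), hμ⟩ else
    ⟨(γ, γ), rfl⟩) ⟨?_, ?_, ?_⟩ ?_
  · intro μ hμ
    have hμ' : 𝒢.src γ = 𝒢.src μ := Eq.symm hμ
    simp [dif_pos hμ']
  · intro μ hμ ν hν hμν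
    have hμ' : 𝒢.src γ = 𝒢.src μ := Eq.symm hμ
    have hν' : 𝒢.src γ = 𝒢.src ν := Eq.symm hν
    simp only [dif_pos hμ', dif_pos hν'] at hμν
    exact congrArg (fun p : Y => p.1.2) hμν
  · rintro ⟨⟨γ', μ⟩, hp⟩ (rfl : γ' = γ)
    exact ⟨μ, Eq.symm hp, by simp only [dif_pos (show 𝒢.src γ' = 𝒢.src μ from hp)]⟩
  · intro μ hμ
    have hμ' : 𝒢.src γ = 𝒢.src μ := Eq.symm hμ
    simp only [dif_pos hμ', F]

theorem hasCompactSupport_convFun (f ξ : C_c(G, ℂ)) : HasCompactSupport (𝒢.convFun f ξ) := by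
  refine HasCompactSupport.intro
    (𝒢.isCompact_mul f.hasCompactSupport.isCompact ξ.hasCompactSupport.isCompact) fun γ hγ => ?_
  refine finsum_mem_eq_zero_of_forall_eq_zero fun μ hμ => ?_
  by_contra h0
  exact hγ (𝒢.mem_mul (Eq.symm hμ) (subset_tsupport _ (left_ne_zero_of_mul h0))
    (subset_tsupport _ (right_ne_zero_of_mul h0)))

/-- Left convolution by `f`, as a linear map on `C_c(G)`. -/
def conv (f : C_c(G, ℂ)) : 𝒢.PreModule →ₗ[ℂ] 𝒢.PreModule where
  toFun ξ := (⟨⟨𝒢.convFun f ξ, 𝒢.continuous_convFun f ξ⟩,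
    𝒢.hasCompactSupport_convFun f ξ⟩ : C_c(G, ℂ))
  map_add' ξ η := PreModule.ext fun γ => by
    classical
    obtain ⟨S, h1, h2⟩ := exists_finset ξ (𝒢.src γ)
    obtain ⟨T, h3, h4⟩ := exists_finset η (𝒢.src γ)
    have hU : ∀ μ ∈ S ∪ T, 𝒢.src μ = 𝒢.src γ := fun μ hμ =>
      (Finset.mem_union.mp hμ).elim (h1 μ) (h3 μ)
    change 𝒢.convFun f (ξ + η : 𝒢.PreModule) γ = 𝒢.convFun f ξ γ + 𝒢.convFun f η γ
    unfold convFun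
    rw [kernel_eq_sum _ ξ hU fun μ h h' => Finset.mem_union_left _ (h2 μ h h'),
      kernel_eq_sum _ η hU fun μ h h' => Finset.mem_union_right _ (h4 μ h h'),
      kernel_eq_sum _ (ξ + η) hU, ← Finset.sum_add_distrib]
    · exact Finset.sum_congr rfl fun μ _ => by rw [PreModule.add_apply, mul_add]
    · intro μ h h'
      by_cases h0 : ξ μ = 0
      · exact Finset.mem_union_right _ (h4 μ h fun h5 => h' (by
          rw [PreModule.add_apply, h0, h5, add_zero]))
      · exact Finset.mem_union_left _ (h2 μ h h0)
  map_smul' z ξ := PreModule.ext fun γ => by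
    obtain ⟨S, h1, h2⟩ := exists_finset ξ (𝒢.src γ)
    change 𝒢.convFun f (z • ξ : 𝒢.PreModule) γ = z * 𝒢.convFun f ξ γ
    unfold convFun
    rw [kernel_eq_sum _ ξ h1 h2, kernel_eq_sum _ (z • ξ) h1, Finset.mul_sum]
    · exact Finset.sum_congr rfl fun μ _ => by rw [PreModule.smul_apply]; ring
    · exact fun μ h h' => h2 μ h fun h0 => h' (by rw [PreModule.smul_apply, h0, mul_zero])

theorem conv_apply (f : C_c(G, ℂ)) (ξ : 𝒢.PreModule) (γ : G) :
    𝒢.conv f ξ γ = ∑ᶠ μ ∈ 𝒢.srcFiber (𝒢.src γ), f (𝒢.mul γ (𝒢.inv μ)) * ξ μ := rfl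

/-- The `n` times iterated commutator `[D_ℓ, [D_ℓ, …, [D_ℓ, Λ(f)]]]` on `C_c(G)`. -/
def iteratedCommutator (ℓ : 𝒢.LengthFunction) (f : C_c(G, ℂ)) :
    ℕ → (𝒢.PreModule →ₗ[ℂ] 𝒢.PreModule)
  | 0 => 𝒢.conv f
  | n + 1 => 𝒢.lengthOp ℓ ∘ₗ iteratedCommutator ℓ f n - iteratedCommutator ℓ f n ∘ₗ 𝒢.lengthOp ℓ

theorem iteratedCommutator_apply (ℓ : 𝒢.LengthFunction) (f : C_c(G, ℂ)) (n : ℕ)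
    (ξ : 𝒢.PreModule) (γ : G) : 𝒢.iteratedCommutator ℓ f n ξ γ =
      ∑ᶠ μ ∈ 𝒢.srcFiber (𝒢.src γ),
        (((ℓ γ - ℓ μ) ^ n : ℝ) * f (𝒢.mul γ (𝒢.inv μ))) * ξ μ := by
  induction n generalizing ξ with
  | zero => simp [iteratedCommutator, conv_apply]
  | succ n ih =>
    obtain ⟨S, h1, h2⟩ := exists_finset ξ (𝒢.src γ)
    have h2' : ∀ μ, 𝒢.src μ = 𝒢.src γ → 𝒢.lengthOp ℓ ξ μ ≠ 0 → μ ∈ S := fun μ h h' =>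
      h2 μ h fun h0 => h' (by rw [lengthOp_apply, h0, mul_zero])
    change 𝒢.lengthOp ℓ (𝒢.iteratedCommutator ℓ f n ξ) γ -
      𝒢.iteratedCommutator ℓ f n (𝒢.lengthOp ℓ ξ) γ = _
    rw [lengthOp_apply, ih, ih, kernel_eq_sum _ ξ h1 h2, kernel_eq_sum _ ξ h1 h2,
      kernel_eq_sum _ (𝒢.lengthOp ℓ ξ) h1 h2', Finset.mul_sum, ← Finset.sum_sub_distrib]
    refine Finset.sum_congr rfl fun μ _ => ?_
    rw [lengthOp_apply, pow_succ]
    push_cast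
    ring

end Convolution

end EtaleGroupoid

namespace EtaleGroupoid

section Schur

/-- The Schur test for finite kernels. -/
theorem schur_finite {G : Type*} {S T : Finset G} {a : G → G → ℝ} {B : ℝ} (ha : ∀ γ μ, 0 ≤ a γ μ)
    (hrow : ∀ γ ∈ T, ∑ μ ∈ S, a γ μ ≤ B) (hcol : ∀ μ ∈ S, ∑ γ ∈ T, a γ μ ≤ B) (hB : 0 ≤ B)
    (x : G → ℝ) :
    ∑ γ ∈ T, (∑ μ ∈ S, a γ μ * x μ) ^ 2 ≤ B ^ 2 * ∑ μ ∈ S, x μ ^ 2 := by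
  have h1 : ∀ γ ∈ T, (∑ μ ∈ S, a γ μ * x μ) ^ 2 ≤ B * ∑ μ ∈ S, a γ μ * x μ ^ 2 := by
    intro γ hγ
    have := Finset.sum_mul_sq_le_sq_mul_sq S (fun μ => √(a γ μ)) (fun μ => √(a γ μ) * x μ)
    have e : ∀ μ, √(a γ μ) * (√(a γ μ) * x μ) = a γ μ * x μ := fun μ => by
      rw [← _root_.mul_assoc, Real.mul_self_sqrt (ha γ μ)]
    have e' : ∀ μ, (√(a γ μ) * x μ) ^ 2 = a γ μ * x μ ^ 2 := fun μ => by
      rw [mul_pow, Real.sq_sqrt (ha γ μ)]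
    simp only [e, e', Real.sq_sqrt (ha γ _)] at this
    refine this.trans ?_
    gcongr
    · exact Finset.sum_nonneg fun μ _ => mul_nonneg (ha γ μ) (sq_nonneg _)
    · exact hrow γ hγ
  calc ∑ γ ∈ T, (∑ μ ∈ S, a γ μ * x μ) ^ 2 ≤ ∑ γ ∈ T, B * ∑ μ ∈ S, a γ μ * x μ ^ 2 :=
        Finset.sum_le_sum h1
    _ = B * ∑ μ ∈ S, (∑ γ ∈ T, a γ μ) * x μ ^ 2 := by
        rw [← Finset.mul_sum, Finset.sum_comm]
        simp only [Finset.sum_mul]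
    _ ≤ B * ∑ μ ∈ S, B * x μ ^ 2 := by
        gcongr with μ hμ
        exact hcol μ hμ
    _ = B ^ 2 * ∑ μ ∈ S, x μ ^ 2 := by
        rw [← Finset.mul_sum, ← _root_.mul_assoc, sq]

theorem sum_le_of_card {ι : Type*} {S : Finset ι} {g : ι → ℝ} {N : ℕ} {C : ℝ} (hC : 0 ≤ C)
    (hg : ∀ i ∈ S, g i ≤ C) (hN : (S.filter fun i => g i ≠ 0).card ≤ N) :
    ∑ i ∈ S, g i ≤ N * C := by
  classical
  rw [← Finset.sum_filter_ne_zero]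
  refine (Finset.sum_le_card_nsmul _ _ C fun i hi => hg i (Finset.mem_filter.mp hi).1).trans ?_
  rw [nsmul_eq_mul]
  gcongr

end Schur

section Representation

variable {G X : Type*} [TopologicalSpace G] [TopologicalSpace X] (𝒢 : EtaleGroupoid G X)

theorem mul_inv_injOn_right {γ : G} :
    Set.InjOn (fun μ => 𝒢.mul γ (𝒢.inv μ)) (𝒢.srcFiber (𝒢.src γ)) := by
  intro μ hμ ν hν h
  have h1 : 𝒢.src γ = 𝒢.src μ := Eq.symm hμ
  have h2 : 𝒢.src γ = 𝒢.src ν := Eq.symm hν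
  have e1 := 𝒢.inv_mul_inv h1
  have e2 := 𝒢.inv_mul_inv h2
  have h' : 𝒢.mul γ (𝒢.inv μ) = 𝒢.mul γ (𝒢.inv ν) := h
  rw [h', e2] at e1
  rw [← 𝒢.mul_inv_cancel_right h1.symm, ← e1, 𝒢.mul_inv_cancel_right h2.symm]

theorem mul_inv_injOn_left {μ : G} :
    Set.InjOn (fun γ => 𝒢.mul γ (𝒢.inv μ)) (𝒢.srcFiber (𝒢.src μ)) := by
  intro γ hγ ν hν h
  have h' : 𝒢.mul γ (𝒢.inv μ) = 𝒢.mul ν (𝒢.inv μ) := h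
  rw [← 𝒢.mul_inv_cancel_right (show 𝒢.src γ = 𝒢.src μ from hγ), h',
    𝒢.mul_inv_cancel_right (show 𝒢.src ν = 𝒢.src μ from hν)]

variable [T2Space G] [T2Space X]

theorem inner_kernel {T S : 𝒢.PreModule →ₗ[ℂ] 𝒢.PreModule} {k k' : G → G → ℂ}
    (hT : ∀ ξ γ, T ξ γ = ∑ᶠ μ ∈ 𝒢.srcFiber (𝒢.src γ), k γ μ * ξ μ)
    (hS : ∀ ξ γ, S ξ γ = ∑ᶠ μ ∈ 𝒢.srcFiber (𝒢.src γ), k' γ μ * ξ μ)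
    (hk : ∀ γ μ, 𝒢.src γ = 𝒢.src μ → k' γ μ = star (k μ γ)) (ξ η : 𝒢.PreModule) :
    ⟪T ξ, η⟫_C(X, ℂ) = ⟪ξ, S η⟫_C(X, ℂ) := by
  ext u
  obtain ⟨A, hA1, hA2⟩ := exists_finset ξ u
  obtain ⟨B, hB1, hB2⟩ := exists_finset η u
  rw [inner_eq_sum _ _ hB1 hB2, inner_eq_sum_left _ _ hA1 hA2]
  have h1 : ∀ γ ∈ B, star (T ξ γ) * η γ = ∑ μ ∈ A, star (k γ μ) * star (ξ μ) * η γ := by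
    intro γ hγ
    rw [hT, hB1 γ hγ, kernel_eq_sum _ ξ hA1 hA2, star_sum, Finset.sum_mul]
    exact Finset.sum_congr rfl fun μ _ => by rw [star_mul']
  have h2 : ∀ μ ∈ A, star (ξ μ) * S η μ = ∑ γ ∈ B, star (k γ μ) * star (ξ μ) * η γ := by
    intro μ hμ
    rw [hS, hA1 μ hμ, kernel_eq_sum _ η hB1 hB2, Finset.mul_sum]
    refine Finset.sum_congr rfl fun γ hγ => ?_
    rw [hk _ _ ((hA1 μ hμ).trans (hB1 γ hγ).symm)]
    ring
  rw [Finset.sum_congr rfl h1, Finset.sum_congr rfl h2, Finset.sum_comm]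

theorem inner_conv (f : C_c(G, ℂ)) (ξ η : 𝒢.PreModule) :
    ⟪𝒢.conv f ξ, η⟫_C(X, ℂ) = ⟪ξ, 𝒢.conv (𝒢.invol f) η⟫_C(X, ℂ) :=
  𝒢.inner_kernel (𝒢.conv_apply f) (𝒢.conv_apply (𝒢.invol f))
    (fun γ μ h => by rw [invol_apply, 𝒢.inv_mul_inv h]) ξ η

theorem inner_iteratedCommutator (ℓ : 𝒢.LengthFunction) (f : C_c(G, ℂ)) (n : ℕ)
    (ξ η : 𝒢.PreModule) : ⟪𝒢.iteratedCommutator ℓ f n ξ, η⟫_C(X, ℂ) =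
      ⟪ξ, ((-1 : ℂ) ^ n • 𝒢.iteratedCommutator ℓ (𝒢.invol f) n) η⟫_C(X, ℂ) := by
  refine 𝒢.inner_kernel (𝒢.iteratedCommutator_apply ℓ f n)
    (k' := fun γ μ => (-1) ^ n *
      (((ℓ γ - ℓ μ) ^ n : ℝ) * 𝒢.invol f (𝒢.mul γ (𝒢.inv μ)))) (fun ζ γ => ?_) (fun γ μ h => ?_) ξ η
  · obtain ⟨S, h1, h2⟩ := exists_finset ζ (𝒢.src γ)
    change (-1 : ℂ) ^ n * 𝒢.iteratedCommutator ℓ (𝒢.invol f) n ζ γ = _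
    rw [iteratedCommutator_apply, kernel_eq_sum _ ζ h1 h2, kernel_eq_sum _ ζ h1 h2,
      Finset.mul_sum]
    exact Finset.sum_congr rfl fun μ _ => by ring
  · rw [invol_apply, 𝒢.inv_mul_inv h, star_mul']
    have : star (((ℓ μ - ℓ γ) ^ n : ℝ) : ℂ) = ((ℓ μ - ℓ γ) ^ n : ℝ) := Complex.conj_ofReal _
    have h2 : (ℓ μ - ℓ γ) ^ n = (-1) ^ n * (ℓ γ - ℓ μ) ^ n := by
      rw [← neg_sub (ℓ γ) (ℓ μ), neg_pow]
    rw [this, h2]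
    push_cast
    ring

variable [CompactSpace X]

theorem exists_bound_kernel {T : 𝒢.PreModule →ₗ[ℂ] 𝒢.PreModule} {k : G → G → ℂ}
    (hT : ∀ ξ γ, T ξ γ = ∑ᶠ μ ∈ 𝒢.srcFiber (𝒢.src γ), k γ μ * ξ μ) {K : Set G}
    (hK : IsCompact K) {C : ℝ} (hC : ∀ γ μ, 𝒢.src γ = 𝒢.src μ → ‖k γ μ‖ ≤ C)
    (hk : ∀ γ μ, 𝒢.src γ = 𝒢.src μ → k γ μ ≠ 0 → 𝒢.mul γ (𝒢.inv μ) ∈ K) :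
    ∃ B, ∀ ξ, ‖T ξ‖ ≤ B * ‖ξ‖ := by
  classical
  by_cases hne : Nonempty G
  swap
  · refine ⟨0, fun ξ => ?_⟩
    rw [show T ξ = 0 from PreModule.ext fun γ => (hne ⟨γ⟩).elim]
    simp
  obtain ⟨γ₀⟩ := hne
  have hC0 : 0 ≤ C := (norm_nonneg _).trans (hC γ₀ γ₀ rfl)
  obtain ⟨N₁, hN₁⟩ := exists_card_le 𝒢.isLocalHomeomorph_src.isLocallyInjective hK
  obtain ⟨N₂, hN₂⟩ := exists_card_le 𝒢.isLocalHomeomorph_rng.isLocallyInjective hK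
  let N := max N₁ N₂
  refine ⟨N * C, fun ξ => ?_⟩
  rw [norm_le_iff _ _ (by positivity)]
  intro u R hR
  obtain ⟨S, h1, h2⟩ := exists_finset ξ u
  have hξ := (𝒢.norm_le_iff ξ (norm_nonneg ξ)).mp le_rfl u S h1
  have hsrc : ∀ γ ∈ R, ∀ μ ∈ S, 𝒢.src γ = 𝒢.src μ := fun γ hγ μ hμ =>
    (hR γ hγ).trans (h1 μ hμ).symm
  let a : G → G → ℝ := fun γ μ => ‖k γ μ‖
  have hrow : ∀ γ ∈ R, ∑ μ ∈ S, a γ μ ≤ N * C := by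
    intro γ hγ
    refine sum_le_of_card hC0 (fun μ hμ => hC _ _ (hsrc γ hγ μ hμ)) ?_
    refine le_trans ?_ (le_max_right N₁ N₂)
    rw [← Finset.card_image_of_injOn (f := fun μ => 𝒢.mul γ (𝒢.inv μ))
      (𝒢.mul_inv_injOn_right.mono fun μ hμ =>
        (hsrc γ hγ μ (Finset.mem_filter.mp hμ).1).symm)]
    refine hN₂ (𝒢.rng γ) _ fun ν hν => ?_
    obtain ⟨μ, hμ, rfl⟩ := Finset.mem_image.mp hν
    rw [Finset.mem_filter] at hμ
    have hs := hsrc γ hγ μ hμ.1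
    exact ⟨hk _ _ hs (norm_ne_zero_iff.mp hμ.2), 𝒢.rng_mul _ _ (by rw [𝒢.rng_inv, hs])⟩
  have hcol : ∀ μ ∈ S, ∑ γ ∈ R, a γ μ ≤ N * C := by
    intro μ hμ
    refine sum_le_of_card hC0 (fun γ hγ => hC _ _ (hsrc γ hγ μ hμ)) ?_
    refine le_trans ?_ (le_max_left N₁ N₂)
    rw [← Finset.card_image_of_injOn (f := fun γ => 𝒢.mul γ (𝒢.inv μ))
      (𝒢.mul_inv_injOn_left.mono fun γ hγ => hsrc γ (Finset.mem_filter.mp hγ).1 μ hμ)]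
    refine hN₁ (𝒢.rng μ) _ fun ν hν => ?_
    obtain ⟨γ, hγ, rfl⟩ := Finset.mem_image.mp hν
    rw [Finset.mem_filter] at hγ
    have hs := hsrc γ hγ.1 μ hμ
    exact ⟨hk _ _ hs (norm_ne_zero_iff.mp hγ.2), by
      rw [𝒢.src_mul _ _ (by rw [𝒢.rng_inv, hs]), 𝒢.src_inv]⟩
  calc ∑ γ ∈ R, ‖T ξ γ‖ ^ 2 ≤ ∑ γ ∈ R, (∑ μ ∈ S, a γ μ * ‖ξ μ‖) ^ 2 := by
        refine Finset.sum_le_sum fun γ hγ => ?_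
        rw [hT, hR γ hγ, kernel_eq_sum _ ξ h1 h2]
        gcongr
        exact (norm_sum_le _ _).trans (Finset.sum_le_sum fun μ _ => (norm_mul _ _).le)
    _ ≤ (N * C) ^ 2 * ∑ μ ∈ S, ‖ξ μ‖ ^ 2 :=
        schur_finite (fun _ _ => norm_nonneg _) hrow hcol (by positivity) _
    _ ≤ (N * C * ‖ξ‖) ^ 2 := by
        rw [mul_pow _ ‖ξ‖]
        gcongr

theorem exists_bound_iteratedCommutator (ℓ : 𝒢.LengthFunction) (f : C_c(G, ℂ)) (n : ℕ) :
    ∃ B, ∀ ξ, ‖𝒢.iteratedCommutator ℓ f n ξ‖ ≤ B * ‖ξ‖ := by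
  have hK := f.hasCompactSupport.isCompact
  obtain ⟨M, hM⟩ := hK.exists_bound_of_continuousOn ℓ.continuous_toFun.continuousOn
  obtain ⟨C, hC⟩ := hK.exists_bound_of_continuousOn (map_continuous f).continuousOn
  refine 𝒢.exists_bound_kernel (𝒢.iteratedCommutator_apply ℓ f n) hK (C := |M| ^ n * |C|) ?_ ?_
  · intro γ μ h
    by_cases hmem : 𝒢.mul γ (𝒢.inv μ) ∈ tsupport f
    · rw [norm_mul, Complex.norm_real, norm_pow, Real.norm_eq_abs]
      have h1 := (LengthFunction.abs_sub_le 𝒢 ℓ h).trans ((le_abs_self _).trans ((hM _ hmem).trans (le_abs_self M)))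
      have h2 := (hC _ hmem).trans (le_abs_self C)
      gcongr
    · rw [image_eq_zero_of_notMem_tsupport hmem, mul_zero, norm_zero]
      positivity
  · intro γ μ _ h
    exact subset_tsupport _ (right_ne_zero_of_mul h)

/-- `δⁿ(f)` as a bounded operator on `C_c(G)` for the norm of `ℰ`. -/
def commutatorCLM (ℓ : 𝒢.LengthFunction) (f : C_c(G, ℂ)) (n : ℕ) :
    𝒢.PreModule →L[ℂ] 𝒢.PreModule :=
  (𝒢.iteratedCommutator ℓ f n).mkContinuousOfExistsBound
    (𝒢.exists_bound_iteratedCommutator ℓ f n)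

/-- The C⋆-algebra `𝓛_{C(X)}(ℰ)` of adjointable operators on `ℰ`. -/
abbrev AdjointableOp : Type _ := HilbertModule.Adjointable C(X, ℂ) 𝒢.HilbertMod

/-- The iterated commutator `δⁿ(f) = [D_ℓ, [D_ℓ, …, [D_ℓ, Λ(f)]]]`, extended to an adjointable
operator on `ℰ`. -/
def delta (ℓ : 𝒢.LengthFunction) (n : ℕ) (f : C_c(G, ℂ)) : 𝒢.AdjointableOp :=
  HilbertModule.extendAdjointable (𝒢.commutatorCLM ℓ f n)
    ((-1 : ℂ) ^ n • 𝒢.commutatorCLM ℓ (𝒢.invol f) n) (𝒢.inner_iteratedCommutator ℓ f n)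

theorem exists_bound_conv (f : C_c(G, ℂ)) : ∃ B, ∀ ξ, ‖𝒢.conv f ξ‖ ≤ B * ‖ξ‖ := by
  have hK := f.hasCompactSupport.isCompact
  obtain ⟨C, hC⟩ := hK.exists_bound_of_continuousOn (map_continuous f).continuousOn
  refine 𝒢.exists_bound_kernel (𝒢.conv_apply f) hK (C := |C|) ?_ ?_
  · intro γ μ _
    by_cases hmem : 𝒢.mul γ (𝒢.inv μ) ∈ tsupport f
    · exact (hC _ hmem).trans (le_abs_self C)
    · rw [image_eq_zero_of_notMem_tsupport hmem, norm_zero]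
      positivity
  · exact fun γ μ _ h => subset_tsupport _ h

/-- Left convolution by `f` as a bounded operator on `C_c(G)` for the norm of `ℰ`. -/
def convCLM (f : C_c(G, ℂ)) : 𝒢.PreModule →L[ℂ] 𝒢.PreModule :=
  (𝒢.conv f).mkContinuousOfExistsBound (𝒢.exists_bound_conv f)

/-- The operator `Λ(f)` of left convolution by `f` on `ℰ`. -/
def convOp (f : C_c(G, ℂ)) : 𝒢.AdjointableOp :=
  HilbertModule.extendAdjointable (𝒢.convCLM f) (𝒢.convCLM (𝒢.invol f)) (𝒢.inner_conv f)

theorem convOp_apply_coe (f : C_c(G, ℂ)) (ξ : 𝒢.PreModule) :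
    (𝒢.convOp f : 𝒢.HilbertMod →L[ℂ] 𝒢.HilbertMod) ξ = (𝒢.conv f ξ : 𝒢.PreModule) :=
  HilbertModule.extendAdjointable_coe _ _ _ ξ

/-- The left regular representation `Λ : C_c(G) → 𝓛_{C(X)}(ℰ)`. -/
def regRep : C_c(G, ℂ) →ₗ[ℂ] 𝒢.AdjointableOp where
  toFun := 𝒢.convOp
  map_add' f g := HilbertModule.adjointable_ext fun ξ => by
    change _ = (𝒢.convOp f : 𝒢.HilbertMod →L[ℂ] 𝒢.HilbertMod) ξ +
      (𝒢.convOp g : 𝒢.HilbertMod →L[ℂ] 𝒢.HilbertMod) ξ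
    rw [convOp_apply_coe, convOp_apply_coe, convOp_apply_coe, ← UniformSpace.Completion.coe_add]
    congr 1
    refine PreModule.ext fun γ => ?_
    obtain ⟨S, h1, h2⟩ := exists_finset ξ (𝒢.src γ)
    change 𝒢.conv _ ξ γ = 𝒢.conv _ ξ γ + 𝒢.conv _ ξ γ
    rw [conv_apply, conv_apply, conv_apply, kernel_eq_sum _ ξ h1 h2, kernel_eq_sum _ ξ h1 h2,
      kernel_eq_sum _ ξ h1 h2, ← Finset.sum_add_distrib]
    exact Finset.sum_congr rfl fun μ _ => add_mul _ _ _
  map_smul' z f := HilbertModule.adjointable_ext fun ξ => by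
    change _ = z • (𝒢.convOp f : 𝒢.HilbertMod →L[ℂ] 𝒢.HilbertMod) ξ
    rw [convOp_apply_coe, convOp_apply_coe, ← UniformSpace.Completion.coe_smul]
    congr 1
    refine PreModule.ext fun γ => ?_
    obtain ⟨S, h1, h2⟩ := exists_finset ξ (𝒢.src γ)
    change 𝒢.conv _ ξ γ = z * 𝒢.conv _ ξ γ
    rw [conv_apply, conv_apply, kernel_eq_sum _ ξ h1 h2, kernel_eq_sum _ ξ h1 h2, Finset.mul_sum]
    exact Finset.sum_congr rfl fun μ _ => _root_.mul_assoc _ _ _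

theorem regRep_apply_coe (f : C_c(G, ℂ)) (ξ : 𝒢.PreModule) :
    (𝒢.regRep f : 𝒢.HilbertMod →L[ℂ] 𝒢.HilbertMod) ξ = (𝒢.conv f ξ : 𝒢.PreModule) :=
  𝒢.convOp_apply_coe f ξ

theorem delta_apply_coe (ℓ : 𝒢.LengthFunction) (n : ℕ) (f : C_c(G, ℂ)) (ξ : 𝒢.PreModule) :
    (𝒢.delta ℓ n f : 𝒢.HilbertMod →L[ℂ] 𝒢.HilbertMod) ξ =
      (𝒢.iteratedCommutator ℓ f n ξ : 𝒢.PreModule) :=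
  HilbertModule.extendAdjointable_coe _ _ _ ξ

theorem conv_one (f : C_c(G, ℂ)) (γ : G) : 𝒢.conv f (PreModule.of 𝒢.one) γ = f γ := by
  rw [conv_apply, 𝒢.finsum_fiber_eq (S := {𝒢.unit (𝒢.src γ)})]
  · rw [Finset.sum_singleton, PreModule.of_apply, 𝒢.one_apply_unit, 𝒢.inv_unit, 𝒢.mul_unit,
      mul_one]
  · simp [𝒢.src_unit]
  · intro μ hμ h
    have : μ ∈ Set.range 𝒢.unit := by
      by_contra hn
      exact h (by rw [PreModule.of_apply, 𝒢.one_apply_of_notMem hn, mul_zero])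
    obtain ⟨u, rfl⟩ := this
    rw [𝒢.src_unit] at hμ
    simp [hμ]

theorem one_conv (ξ : 𝒢.PreModule) : 𝒢.conv 𝒢.one ξ = ξ := by
  refine PreModule.ext fun γ => ?_
  rw [conv_apply, 𝒢.finsum_fiber_eq (S := {γ})]
  · rw [Finset.sum_singleton, 𝒢.mul_inv, 𝒢.one_apply_unit, one_mul]
  · simp
  · intro μ hμ h
    have : 𝒢.mul γ (𝒢.inv μ) ∈ Set.range 𝒢.unit := by
      by_contra hn
      exact h (by rw [𝒢.one_apply_of_notMem hn, zero_mul])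
    obtain ⟨u, hu⟩ := this
    have h1 := 𝒢.mul_inv_cancel_right hμ.symm
    rw [← hu] at h1
    have h2 : u = 𝒢.rng μ := by
      have := congrArg 𝒢.src hu
      rwa [𝒢.src_unit, 𝒢.src_mul _ _ (by rw [𝒢.rng_inv, hμ]), 𝒢.src_inv] at this
    rw [h2, 𝒢.unit_mul] at h1
    exact Finset.mem_singleton.mpr h1

theorem regRep_injective : Function.Injective 𝒢.regRep := by
  intro f g h
  have h1 : ((𝒢.conv f (PreModule.of 𝒢.one) : 𝒢.PreModule) : 𝒢.HilbertMod) =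
      (𝒢.conv g (PreModule.of 𝒢.one) : 𝒢.PreModule) := by
    rw [← regRep_apply_coe, ← regRep_apply_coe, h]
  have h2 := UniformSpace.Completion.coe_injective _ h1
  ext γ
  rw [← 𝒢.conv_one f, ← 𝒢.conv_one g, h2]

theorem regRep_one : 𝒢.regRep 𝒢.one = 1 :=
  HilbertModule.adjointable_ext fun ξ => by
    rw [regRep_apply_coe, one_conv]
    rfl

theorem regRep_invol (f : C_c(G, ℂ)) : 𝒢.regRep (𝒢.invol f) = star (𝒢.regRep f) := by
  refine (HilbertModule.star_eq_of_inner fun x y => ?_).symm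
  refine UniformSpace.Completion.induction_on₂ x y (isClosed_eq ?_ ?_) fun b c => ?_
  · exact HilbertModule.continuous_inner_completion.comp
      (((ContinuousLinearMap.continuous _).comp continuous_fst).prodMk continuous_snd)
  · exact HilbertModule.continuous_inner_completion.comp
      (continuous_fst.prodMk ((ContinuousLinearMap.continuous _).comp continuous_snd))
  · rw [regRep_apply_coe, regRep_apply_coe, HilbertModule.inner_coe, HilbertModule.inner_coe,
      inner_conv]

/-- The reduced C⋆-algebra `C_r^*(G)`, the C⋆-subalgebra of `𝓛_{C(X)}(ℰ)` generated by
`Λ(C_c(G))`, i.e. the norm closure of the range of the left regular representation. -/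
def reducedSubalgebra : StarSubalgebra ℂ 𝒢.AdjointableOp :=
  (StarAlgebra.adjoin ℂ (Set.range 𝒢.regRep)).topologicalClosure

/-- The reduced C⋆-algebra as a type. -/
abbrev ReducedCStar : Type _ := 𝒢.reducedSubalgebra

instance : CStarAlgebra 𝒢.ReducedCStar :=
  StarSubalgebra.cstarAlgebra _ (h_closed := StarSubalgebra.isClosed_topologicalClosure _)

/-- The inclusion `C_c(G) → C_r^*(G)`. -/
def toReduced : C_c(G, ℂ) →ₗ[ℂ] 𝒢.ReducedCStar where
  toFun f := ⟨𝒢.regRep f, StarSubalgebra.le_topologicalClosure _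
    (StarAlgebra.subset_adjoin ℂ _ (Set.mem_range_self f))⟩
  map_add' f g := Subtype.ext (map_add 𝒢.regRep f g)
  map_smul' z f := Subtype.ext (map_smul 𝒢.regRep z f)

theorem toReduced_injective : Function.Injective 𝒢.toReduced := fun _ _ h =>
  𝒢.regRep_injective (congrArg Subtype.val h)

theorem toReduced_one : 𝒢.toReduced 𝒢.one = 1 := Subtype.ext 𝒢.regRep_one

theorem toReduced_invol (f : C_c(G, ℂ)) : 𝒢.toReduced (𝒢.invol f) = star (𝒢.toReduced f) :=
  Subtype.ext (𝒢.regRep_invol f)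

end Representation

end EtaleGroupoid

/-! ### Operator systems and compact quantum metric spaces -/

/-- An operator system: a unital and `*`-invariant subspace of a unital C⋆-algebra. -/
structure OperatorSystem (A : Type*) [CStarAlgebra A] extends Submodule ℂ A where
  one_mem' : (1 : A) ∈ carrier
  star_mem' : ∀ {x : A}, x ∈ carrier → star x ∈ carrier

namespace OperatorSystem

variable {A : Type*} [CStarAlgebra A] (𝒳 : OperatorSystem A)

/-- The type of elements of an operator system. -/
abbrev Elem : Type _ := 𝒳.toSubmodule

/-- The unit of an operator system. -/
def unit : 𝒳.Elem := ⟨1, 𝒳.one_mem'⟩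

/-- The involution of an operator system. -/
def adj (x : 𝒳.Elem) : 𝒳.Elem := ⟨star (x : A), 𝒳.star_mem' x.2⟩

/-- The state space `S(𝒳)`: the unital functionals which are nonnegative on the elements of `𝒳`
that are positive in the ambient C⋆-algebra. It carries the weak-* topology. -/
def stateSpace : Set (WeakDual ℂ 𝒳.Elem) :=
  {φ | φ 𝒳.unit = 1 ∧ ∀ x : 𝒳.Elem, (∃ b : A, (x : A) = star b * b) → 0 ≤ φ x}

variable {𝒳}

/-- A slip-norm: a `*`-invariant seminorm whose kernel contains the scalars. -/
structure IsSlipNorm (L : 𝒳.Elem → ℝ) : Prop where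
  nonneg : ∀ x, 0 ≤ L x
  add_le : ∀ x y, L (x + y) ≤ L x + L y
  smul : ∀ (z : ℂ) x, L (z • x) = ‖z‖ * L x
  adj : ∀ x, L (𝒳.adj x) = L x
  scalar : ∀ z : ℂ, L (z • 𝒳.unit) = 0

/-- The Monge–Kantorovič extended (pseudo)metric
`mk_L(φ, ψ) = sup {|φ(x) - ψ(x)| : L(x) ≤ 1}` on the state space. -/
abbrev mkMetric (L : 𝒳.Elem → ℝ) : PseudoEMetricSpace 𝒳.stateSpace where
  edist φ ψ := ⨆ (x : 𝒳.Elem) (_ : L x ≤ 1), ‖φ.1 x - ψ.1 x‖ₑ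
  edist_self φ := by simp
  edist_comm φ ψ := by simp only [← edist_eq_enorm_sub, edist_comm]
  edist_triangle φ ψ χ := by
    refine iSup₂_le fun x hx => ?_
    simp only [← edist_eq_enorm_sub]
    refine (edist_triangle _ (ψ.1 x) _).trans (add_le_add ?_ ?_)
    · exact le_iSup₂ (f := fun (x : 𝒳.Elem) (_ : L x ≤ 1) => edist (φ.1 x) (ψ.1 x)) x hx
    · exact le_iSup₂ (f := fun (x : 𝒳.Elem) (_ : L x ≤ 1) => edist (ψ.1 x) (χ.1 x)) x hx

/-- `(𝒳, L)` is a compact quantum metric space if `L` is a slip-norm and its Monge–Kantorovič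
metric induces the weak-* topology on the state space (this topology is Hausdorff, so that the
extended pseudometric is then an extended metric). -/
def IsCompactQuantumMetricSpace (L : 𝒳.Elem → ℝ) : Prop :=
  IsSlipNorm L ∧
    (mkMetric L).toUniformSpace.toTopologicalSpace =
      (instTopologicalSpaceSubtype : TopologicalSpace 𝒳.stateSpace)

end OperatorSystem

/-! ### Metric stratifications and the seminorms `L^{𝒦,n}` -/

namespace EtaleGroupoid

section Stratification

variable {G X : Type*} [TopologicalSpace G] [MetricSpace X] (𝒢 : EtaleGroupoid G X)

/-- `max (d(s(γ), s(μ))) (d(r(γ), r(μ)))`. -/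
def arrowDist (γ μ : G) : ℝ :=
  max (dist (𝒢.src γ) (𝒢.src μ)) (dist (𝒢.rng γ) (𝒢.rng μ))

/-- A family `K` of sets of arrows is a metric stratification of `𝒢` (with respect to the metric
of the unit space). The index set is required to be countable. -/
structure IsMetricStratification {I : Type*} (K : I → Set G) : Prop where
  countable : Countable I
  iUnion_eq : ⋃ i, K i = Set.univ
  isCompact_closure : ∀ i, IsCompact (closure (K i))
  isOpen : ∀ i, IsOpen (K i)
  disjoint : ∀ i j, i ≠ j → Disjoint (K i) (K j)
  inv : ∀ i, ∃ j, K j = 𝒢.inv '' K i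
  unit : ∃ e, K e = Set.range 𝒢.unit
  eq_of_arrowDist_eq_zero : ∀ i, ∀ γ ∈ K i, ∀ μ ∈ K i, 𝒢.arrowDist γ μ = 0 → γ = μ
  totallyBounded : ∀ i, ∀ ε > 0, ∃ F : Finset G, ↑F ⊆ K i ∧
    ∀ γ ∈ K i, ∃ μ ∈ F, 𝒢.arrowDist γ μ < ε

/-- The global Lipschitz constant
`sup_i sup {|f(γ) - f(μ)| / d^{(i)}(γ, μ) : γ, μ ∈ K_i}`, possibly infinite (with `0 / 0 = 0`). -/
def lipConst {I : Type*} (K : I → Set G) (f : C_c(G, ℂ)) : ℝ≥0∞ :=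
  ⨆ (i : I) (γ ∈ K i) (μ ∈ K i), ‖f γ - f μ‖ₑ / ENNReal.ofReal (𝒢.arrowDist γ μ)

theorem lipConst_le {I : Type*} {K : I → Set G} {f : C_c(G, ℂ)} {c : ℝ≥0∞}
    (h : ∀ i, ∀ γ ∈ K i, ∀ μ ∈ K i, ‖f γ - f μ‖ₑ / ENNReal.ofReal (𝒢.arrowDist γ μ) ≤ c) :
    𝒢.lipConst K f ≤ c :=
  iSup_le fun i => iSup₂_le fun γ hγ => iSup₂_le fun μ hμ => h i γ hγ μ hμ

theorem le_lipConst {I : Type*} {K : I → Set G} (f : C_c(G, ℂ)) {i : I} {γ μ : G} (hγ : γ ∈ K i)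
    (hμ : μ ∈ K i) : ‖f γ - f μ‖ₑ / ENNReal.ofReal (𝒢.arrowDist γ μ) ≤ 𝒢.lipConst K f :=
  le_iSup_of_le i <| le_iSup₂_of_le γ hγ <|
    le_iSup₂ (f := fun μ (_ : μ ∈ K i) => ‖f γ - f μ‖ₑ / ENNReal.ofReal (𝒢.arrowDist γ μ)) μ hμ

variable [T2Space G] [CompactSpace X]

/-- A sub-operator system of `C_c(G)`: a subspace of `C_c(G)` containing the unit and invariant
under the involution. -/
structure SubOperatorSystem extends Submodule ℂ C_c(G, ℂ) where
  one_mem' : 𝒢.one ∈ carrier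
  invol_mem' : ∀ {f : C_c(G, ℂ)}, f ∈ carrier → 𝒢.invol f ∈ carrier

variable {𝒢} in
/-- A sub-operator system of `C_c(G)`, realized as an operator system in `C_r^*(G)`. -/
def SubOperatorSystem.toOperatorSystem (𝒳 : 𝒢.SubOperatorSystem) :
    OperatorSystem 𝒢.ReducedCStar where
  toSubmodule := 𝒳.toSubmodule.map 𝒢.toReduced
  one_mem' := ⟨𝒢.one, 𝒳.one_mem', 𝒢.toReduced_one⟩
  star_mem' := by
    rintro _ ⟨f, hf, rfl⟩
    exact ⟨𝒢.invol f, 𝒳.invol_mem' hf, 𝒢.toReduced_invol f⟩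

variable {𝒢} in
/-- The function in `𝒳 ⊆ C_c(G)` corresponding to an element of the operator system in
`C_r^*(G)`. -/
def SubOperatorSystem.fn (𝒳 : 𝒢.SubOperatorSystem) (x : 𝒳.toOperatorSystem.Elem) : C_c(G, ℂ) :=
  ((Submodule.equivMapOfInjective 𝒢.toReduced 𝒢.toReduced_injective 𝒳.toSubmodule).symm x :
    𝒳.toSubmodule)

variable {𝒢} in
/-- `(𝒳, L|_𝒳)` is a compact quantum metric space, for a sub-operator system `𝒳` of `C_c(G)` and
a function `L` on `C_c(G)`. -/
def SubOperatorSystem.IsCompactQuantumMetricSpace (𝒳 : 𝒢.SubOperatorSystem)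
    (L : C_c(G, ℂ) → ℝ) : Prop :=
  OperatorSystem.IsCompactQuantumMetricSpace fun x : 𝒳.toOperatorSystem.Elem => L (𝒳.fn x)

/-- The operator system of all `f ∈ C_c(G)` with finite global Lipschitz constant. -/
def lipSystem {I : Type*} {K : I → Set G} (hK : 𝒢.IsMetricStratification K) :
    𝒢.SubOperatorSystem where
  carrier := {f | 𝒢.lipConst K f < ⊤}
  add_mem' := by
    intro f g hf hg
    refine lt_of_le_of_lt (𝒢.lipConst_le (c := 𝒢.lipConst K f + 𝒢.lipConst K g) ?_)
      (ENNReal.add_lt_top.mpr ⟨hf, hg⟩)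
    intro i γ hγ μ hμ
    refine le_trans ?_ (add_le_add (𝒢.le_lipConst f hγ hμ) (𝒢.le_lipConst g hγ hμ))
    rw [← ENNReal.add_div]
    refine ENNReal.div_le_div_right ?_ _
    have : (f + g) γ - (f + g) μ = (f γ - f μ) + (g γ - g μ) := by
      simp only [CompactlySupportedContinuousMap.add_apply]
      ring
    rw [this]
    exact enorm_add_le _ _
  zero_mem' := lt_of_le_of_lt (𝒢.lipConst_le (c := 0) (by simp)) ENNReal.zero_lt_top
  smul_mem' := by
    intro z f hf
    refine lt_of_le_of_lt (𝒢.lipConst_le (c := ‖z‖ₑ * 𝒢.lipConst K f) ?_)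
      (ENNReal.mul_lt_top enorm_lt_top hf)
    intro i γ hγ μ hμ
    refine le_trans ?_ (mul_le_mul_right (𝒢.le_lipConst f hγ hμ) _)
    have : (z • f) γ - (z • f) μ = z * (f γ - f μ) := by
      simp only [CompactlySupportedContinuousMap.smul_apply, smul_eq_mul]
      ring
    rw [this, enorm_mul, mul_div_assoc]
  one_mem' := by
    refine lt_of_le_of_lt (𝒢.lipConst_le (c := 0) ?_) ENNReal.zero_lt_top
    intro i γ hγ μ hμ
    obtain ⟨e, he⟩ := hK.unit
    suffices h : 𝒢.one γ = 𝒢.one μ by simp [h]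
    by_cases hi : i = e
    · subst hi
      rw [he] at hγ hμ
      obtain ⟨u, rfl⟩ := hγ
      obtain ⟨v, rfl⟩ := hμ
      rw [𝒢.one_apply_unit, 𝒢.one_apply_unit]
    · have hd := hK.disjoint i e hi
      rw [he] at hd
      rw [𝒢.one_apply_of_notMem (Set.disjoint_left.mp hd hγ),
        𝒢.one_apply_of_notMem (Set.disjoint_left.mp hd hμ)]
  invol_mem' := by
    intro f hf
    refine lt_of_le_of_lt (𝒢.lipConst_le ?_) hf
    intro i γ hγ μ hμ
    obtain ⟨j, hj⟩ := hK.inv i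
    have h := 𝒢.le_lipConst f (i := j) (hj ▸ Set.mem_image_of_mem _ hγ)
      (hj ▸ Set.mem_image_of_mem _ hμ)
    refine le_trans (le_of_eq ?_) h
    rw [invol_apply, invol_apply, ← star_sub, arrowDist, arrowDist, 𝒢.src_inv, 𝒢.src_inv,
      𝒢.rng_inv, 𝒢.rng_inv, max_comm]
    congr 1
    simp only [enorm_eq_nnnorm, nnnorm_star]

/-- The total seminorm `L^{𝒦,n}(f) = max {‖δⁿ(f)‖, L^𝒦_Lip(f)}`. -/
def totalSeminorm (ℓ : 𝒢.LengthFunction) {I : Type*} (K : I → Set G) (n : ℕ) (f : C_c(G, ℂ)) : ℝ :=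
  max ‖𝒢.delta ℓ n f‖ (𝒢.lipConst K f).toReal

end Stratification

end EtaleGroupoid

end

/-! By Rieffel's criterion it suffices that the unit ball of the slip-norm is totally bounded in
operator norm modulo the scalars. Finitely many values then control `ψ - φ` on that whole ball up to
a small error, because states are uniformly bounded and agree on scalars. So every Monge–Kantorovič
ball is a weak* neighbourhood of its centre (`IsSlipNorm.isCompactQuantumMetricSpace`). The reverse
comparison of topologies needs only that `L` is finite.

Total boundedness is an Arzelà–Ascoli argument in which the two halves of the seminorm complement
each other. The Lipschitz constant bounds oscillation within each stratum, but says nothing about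
the size of a function that is constant there. Off the unit space the size is controlled by the
commutator: applying `δⁿ(f)` to the vector `1` of norm at most one gives `ℓⁿ f`, and `ℓ` is bounded
below by a positive constant on the non-units of a ball. On the unit space `ℓ` vanishes and the
commutator gives no information. There the Lipschitz bound takes over: the units form a single
stratum of finite diameter, so a function vanishing at one chosen unit is bounded, and this
normalisation is achieved by subtracting a scalar (`exists_uniform_bound`).

The compact ball carrying all supports is covered by finitely many strata, each totally bounded.
Sampling at finitely many points thus determines a Lipschitz function up to a small uniform error
(`norm_sub_le_of_sampling`), and the vectors of samples range over a bounded subset of a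
finite-dimensional space. Finally, on functions with support in a fixed compact set the reduced norm
is at most a constant times the uniform norm (`exists_norm_toReduced_le`), which turns the uniform
net into an operator norm net (`exists_finite_net`). -/

namespace OperatorSystem

/-! ### States on operator systems and the total boundedness criterion -/

variable {A : Type*} [CStarAlgebra A] {𝒳 : OperatorSystem A}

/-- A shortcut: instance search through the subspace is slow for concrete algebras. -/
noncomputable instance : NormedAddCommGroup 𝒳.Elem := inferInstance

noncomputable instance : Module ℂ 𝒳.Elem := inferInstance

noncomputable instance : SMul ℂ 𝒳.Elem := inferInstance

/-- For self-adjoint `y` the element `‖y‖ • 1 - y` is `star b * b` with `b` in the ambient algebra,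
usually outside `𝒳`; the definition of a state only asks for that. Positivity for `x` and `-x` then
makes `φ x` real and bounds it on both sides. -/
theorem norm_apply_le_of_isSelfAdjoint {φ : WeakDual ℂ 𝒳.Elem} (hφ : φ ∈ 𝒳.stateSpace)
    {x : 𝒳.Elem} (hx : IsSelfAdjoint (x : A)) : ‖φ x‖ ≤ ‖x‖ := by
  let _ : PartialOrder A := CStarAlgebra.spectralOrder A
  have _ : StarOrderedRing A := CStarAlgebra.spectralOrderedRing A
  have key : ∀ y : 𝒳.Elem, IsSelfAdjoint (y : A) → 0 ≤ (‖y‖ : ℂ) - φ y := by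
    intro y hy
    have h1 : 0 ≤ algebraMap ℝ A ‖(y : A)‖ - (y : A) :=
      sub_nonneg.mpr hy.le_algebraMap_norm_self
    have h2 := hφ.2 ((‖y‖ : ℂ) • 𝒳.unit - y) (by
      obtain ⟨b, hb⟩ := CStarAlgebra.nonneg_iff_eq_star_mul_self.mp h1
      refine ⟨b, ?_⟩
      rw [← hb, Algebra.algebraMap_eq_smul_one]
      change (‖y‖ : ℂ) • (1 : A) - (y : A) = ‖y‖ • (1 : A) - (y : A)
      rw [Complex.coe_smul])
    rwa [map_sub, map_smul, hφ.1, smul_eq_mul, mul_one] at h2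
  have h1 := key x hx
  have h2 := key (-x) (by simpa using hx.neg)
  rw [norm_neg, map_neg, sub_neg_eq_add] at h2
  rw [Complex.nonneg_iff] at h1 h2
  simp only [Complex.sub_re, Complex.ofReal_re, Complex.sub_im, Complex.ofReal_im,
    Complex.add_re] at h1 h2
  have h3 : φ x = ((φ x).re : ℂ) := Complex.ext (by simp) (by simpa using h1.2.symm)
  rw [h3, Complex.norm_real, Real.norm_eq_abs, abs_le]
  constructor <;> linarith [h1.1, h2.1]

/-- Split into self-adjoint parts. The constant 2 is not sharp, but any uniform constant serves the
criterion below. -/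
theorem norm_apply_le {φ : WeakDual ℂ 𝒳.Elem} (hφ : φ ∈ 𝒳.stateSpace) (x : 𝒳.Elem) :
    ‖φ x‖ ≤ 2 * ‖x‖ := by
  have hadj : ‖𝒳.adj x‖ = ‖x‖ := norm_star (x : A)
  let a : 𝒳.Elem := x + 𝒳.adj x
  let b : 𝒳.Elem := Complex.I • (𝒳.adj x - x)
  have ha : ‖φ a‖ ≤ 2 * ‖x‖ :=
    (norm_apply_le_of_isSelfAdjoint hφ (IsSelfAdjoint.add_star_self (x : A))).trans
      ((norm_add_le _ _).trans (by rw [hadj, two_mul]))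
  have hb : ‖φ b‖ ≤ 2 * ‖x‖ := by
    refine (norm_apply_le_of_isSelfAdjoint hφ ?_).trans ?_
    · change star (Complex.I • (star (x : A) - (x : A))) = Complex.I • (star (x : A) - (x : A))
      rw [star_smul, star_sub, star_star, Complex.star_def, Complex.conj_I, neg_smul, ← smul_neg,
        neg_sub]
    · rw [norm_smul, Complex.norm_I, one_mul]
      exact (norm_sub_le _ _).trans (by rw [hadj, two_mul])
  have hx : (2 : ℂ) • x = a + Complex.I • b := by
    simp only [a, b, smul_smul, Complex.I_mul_I]
    module
  have h := congrArg (fun y => ‖φ y‖) hx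
  simp only [map_smul, map_add, smul_eq_mul, norm_mul, Complex.norm_ofNat] at h
  have h' := norm_add_le (φ a) (Complex.I * φ b)
  rw [norm_mul, Complex.norm_I, one_mul] at h'
  linarith

/-- Rescaling `x` into the unit ball of `L` makes evaluation at `x` Lipschitz for `mkMetric L`. This
is the half of the criterion that needs no compactness. -/
theorem IsSlipNorm.continuous_apply {L : 𝒳.Elem → ℝ} (hL : IsSlipNorm L) (x : 𝒳.Elem) :
    @Continuous _ _ (mkMetric L).toUniformSpace.toTopologicalSpace _
      fun φ : 𝒳.stateSpace => φ.1 x := by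
  let _ := mkMetric L
  have hpos : 0 < L x + 1 := by linarith [hL.nonneg x]
  refine (LipschitzWith.continuous (K := (L x + 1).toNNReal) fun φ ψ => ?_)
  -- The `+ 1` keeps the scaling factor nonzero when `L x = 0`.
  set r : ℂ := ((L x + 1 : ℝ) : ℂ)
  have hr : r ≠ 0 := Complex.ofReal_ne_zero.mpr hpos.ne'
  have hrn : ‖r‖ = L x + 1 := by rw [Complex.norm_real, Real.norm_of_nonneg hpos.le]
  have h1 : L (r⁻¹ • x) ≤ 1 := by
    rw [hL.smul, norm_inv, hrn, inv_mul_le_iff₀ hpos]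
    linarith
  have h2 : ‖φ.1 (r⁻¹ • x) - ψ.1 (r⁻¹ • x)‖ₑ ≤ edist φ ψ :=
    le_iSup₂ (f := fun (x : 𝒳.Elem) (_ : L x ≤ 1) => ‖φ.1 x - ψ.1 x‖ₑ) (r⁻¹ • x) h1
  have h3 : φ.1 x - ψ.1 x = r * (φ.1 (r⁻¹ • x) - ψ.1 (r⁻¹ • x)) := by
    rw [map_smul, map_smul, smul_eq_mul, smul_eq_mul]
    field_simp
  rw [edist_eq_enorm_sub, h3, enorm_mul]
  refine mul_le_mul' (le_of_eq ?_) h2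
  rw [← ofReal_norm, hrn]
  rfl

/-- A slip-norm whose unit ball is totally bounded modulo the scalars defines a compact quantum
metric space. -/
theorem IsSlipNorm.isCompactQuantumMetricSpace {L : 𝒳.Elem → ℝ} (hL : IsSlipNorm L)
    (h : ∀ ε > 0, ∃ F : Set 𝒳.Elem, F.Finite ∧
      ∀ x, L x ≤ 1 → ∃ y ∈ F, ∃ z : ℂ, ‖x - z • 𝒳.unit - y‖ < ε) :
    IsCompactQuantumMetricSpace L := by
  refine ⟨hL, le_antisymm ?_ ?_⟩
  · exact continuous_iff_le_induced.mp (@WeakBilin.continuous_of_continuous_eval _ ℂ _ _ _ _ _ _ _ _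
      (topDualPairing ℂ 𝒳.Elem) (mkMetric L).toUniformSpace.toTopologicalSpace _
      fun x => hL.continuous_apply x)
  -- It remains to see that each closed Monge–Kantorovič ball is a weak* neighbourhood of its
  -- centre.
  · refine le_of_nhds_le_nhds fun φ => ?_
    refine (@Metric.nhds_basis_closedEBall _ (mkMetric L) φ).ge_iff.mpr fun ε hε => ?_
    -- The radius `ε` may be infinite, so a finite `δ` below it is used.
    obtain ⟨δ, hδ, hδε⟩ := ENNReal.lt_iff_exists_nnreal_btwn.mp hε
    have hδ0 : (0 : ℝ) < δ := by exact_mod_cast hδ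
    -- Each of the two states contributes at most `2 * (δ / 8)` on the remainder, and the net point
    -- contributes `δ / 2`, for a total of `δ`.
    obtain ⟨F, hF, hcov⟩ := h (δ / 8) (by positivity)
    have hev : ∀ᶠ ψ : 𝒳.stateSpace in 𝓝 φ, ∀ y ∈ F, dist (ψ.1 y) (φ.1 y) < δ / 2 :=
      (Filter.eventually_all_finite hF).mpr fun y _ =>
        Metric.tendsto_nhds.mp
          (((WeakDual.eval_continuous y).comp continuous_subtype_val).tendsto φ) _ (by positivity)
    filter_upwards [hev] with ψ hψ
    refine le_trans (iSup₂_le fun x hx => ?_) hδε.le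
    obtain ⟨y, hy, z, hz⟩ := hcov x hx
    -- The scalar part cancels because both states are unital.
    have hxy : ψ.1 x - φ.1 x = ψ.1 (x - z • 𝒳.unit - y) - φ.1 (x - z • 𝒳.unit - y) +
        (ψ.1 y - φ.1 y) := by
      simp only [map_sub, map_smul, ψ.2.1, φ.2.1]
      ring
    have h1 := norm_apply_le ψ.2 (x - z • 𝒳.unit - y)
    have h2 := norm_apply_le φ.2 (x - z • 𝒳.unit - y)
    have h3 := hψ y hy
    rw [dist_eq_norm] at h3
    have h4 : ‖ψ.1 x - φ.1 x‖ ≤ δ := by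
      rw [hxy]
      refine (norm_add_le _ _).trans ?_
      have := norm_sub_le (ψ.1 (x - z • 𝒳.unit - y)) (φ.1 (x - z • 𝒳.unit - y))
      linarith
    rw [← ofReal_norm]
    exact (ENNReal.ofReal_le_ofReal h4).trans (ENNReal.ofReal_coe_nnreal).le

end OperatorSystem

/-! ### Comparison of the module, uniform and reduced norms -/

namespace EtaleGroupoid

section RegularRepresentation

variable {G X : Type*} [TopologicalSpace G] [TopologicalSpace X]

/-- The pointwise absolute value of a vector of the pre-Hilbert module. -/
noncomputable def PreModule.abs {𝒢 : EtaleGroupoid G X} (ξ : 𝒢.PreModule) : 𝒢.PreModule :=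
  (⟨⟨fun γ => (‖ξ γ‖ : ℂ),
    Complex.continuous_ofReal.comp (map_continuous (show C_c(G, ℂ) from ξ)).norm⟩,
    (show C_c(G, ℂ) from ξ).hasCompactSupport.comp_left (g := fun z : ℂ => (‖z‖ : ℂ))
      (by simp)⟩ : C_c(G, ℂ))

theorem PreModule.abs_apply {𝒢 : EtaleGroupoid G X} (ξ : 𝒢.PreModule) (γ : G) :
    ξ.abs γ = (‖ξ γ‖ : ℂ) := rfl

variable [T2Space G] [T2Space X] {𝒢 : EtaleGroupoid G X}

/-- With `k` and `|ξ|` nonnegative there is no cancellation in the convolution on the right, so it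
dominates the left side term by term. This allows one cutoff kernel to bound all kernels below it.
-/
theorem norm_conv_apply_le {f h : C_c(G, ℂ)} {k : G → ℝ} {c : ℝ} (hk : ∀ γ, h γ = k γ)
    (hf : ∀ γ, ‖f γ‖ ≤ c * k γ) (hk0 : ∀ γ, 0 ≤ k γ) (ξ : 𝒢.PreModule) (γ : G) :
    ‖𝒢.conv f ξ γ‖ ≤ c * ‖𝒢.conv h ξ.abs γ‖ := by
  obtain ⟨S, h1, h2⟩ := exists_finset ξ (𝒢.src γ)
  rw [conv_apply, conv_apply, kernel_eq_sum _ ξ h1 h2,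
    kernel_eq_sum _ ξ.abs h1 fun μ hμ h' => h2 μ hμ fun h0 => h' (by simp [PreModule.abs_apply, h0])]
  have e : ∑ μ ∈ S, h (𝒢.mul γ (𝒢.inv μ)) * ξ.abs μ =
      ((∑ μ ∈ S, k (𝒢.mul γ (𝒢.inv μ)) * ‖ξ μ‖ : ℝ) : ℂ) := by
    push_cast
    exact Finset.sum_congr rfl fun μ _ => by rw [hk, PreModule.abs_apply]
  rw [e, Complex.norm_real, Real.norm_of_nonneg
    (Finset.sum_nonneg fun μ _ => mul_nonneg (hk0 _) (norm_nonneg _)), Finset.mul_sum]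
  refine (norm_sum_le _ _).trans (Finset.sum_le_sum fun μ _ => ?_)
  rw [norm_mul, ← _root_.mul_assoc]
  gcongr
  exact hf _

variable [CompactSpace X]

theorem norm_le_mul_of_pointwise {ξ η : 𝒢.PreModule} {c : ℝ} (hc : 0 ≤ c)
    (h : ∀ γ, ‖ξ γ‖ ≤ c * ‖η γ‖) : ‖ξ‖ ≤ c * ‖η‖ := by
  rw [norm_le_iff _ _ (by positivity)]
  intro u S hS
  calc ∑ γ ∈ S, ‖ξ γ‖ ^ 2 ≤ ∑ γ ∈ S, c ^ 2 * ‖η γ‖ ^ 2 := by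
        refine Finset.sum_le_sum fun γ _ => ?_
        rw [← mul_pow]
        gcongr
        exact h γ
    _ = c ^ 2 * ∑ γ ∈ S, ‖η γ‖ ^ 2 := by rw [Finset.mul_sum]
    _ ≤ (c * ‖η‖) ^ 2 := by
        rw [mul_pow]
        gcongr
        exact (𝒢.norm_le_iff η (norm_nonneg η)).mp le_rfl u S hS

theorem PreModule.norm_abs_le (ξ : 𝒢.PreModule) : ‖ξ.abs‖ ≤ ‖ξ‖ := by
  simpa using norm_le_mul_of_pointwise zero_le_one fun γ => by
    rw [abs_apply, Complex.norm_real, norm_norm, one_mul]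

/-- A single arrow is one term of the sum over its source fiber. -/
theorem norm_apply_le_norm (ξ : 𝒢.PreModule) (γ : G) : ‖ξ γ‖ ≤ ‖ξ‖ := by
  have h := (𝒢.norm_le_iff ξ (norm_nonneg ξ)).mp le_rfl (𝒢.src γ) {γ} (by simp)
  rw [Finset.sum_singleton] at h
  exact (pow_le_pow_iff_left₀ (norm_nonneg _) (norm_nonneg _) two_ne_zero).mp h

/-- Each source fiber contains exactly one unit, so a finite fiber sum has at most one nonzero term,
equal to 1. -/
theorem norm_one_le : ‖(PreModule.of 𝒢.one : 𝒢.PreModule)‖ ≤ 1 := by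
  classical
  rw [norm_le_iff _ _ zero_le_one]
  intro u S hS
  have h : ∀ γ ∈ S, ‖(PreModule.of 𝒢.one : 𝒢.PreModule) γ‖ ^ 2 =
      if γ = 𝒢.unit u then (1 : ℝ) else 0 := by
    intro γ hγ
    rw [PreModule.of_apply]
    by_cases hm : γ ∈ Set.range 𝒢.unit
    · obtain ⟨v, rfl⟩ := hm
      have := hS _ hγ
      rw [𝒢.src_unit] at this
      simp [one_apply_unit, this]
    · rw [one_apply_of_notMem _ hm, if_neg fun h => hm ⟨u, h.symm⟩]
      simp
  rw [Finset.sum_congr rfl h, Finset.sum_ite_eq']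
  split_ifs <;> norm_num

theorem norm_le_of_forall_coe {T : 𝒢.AdjointableOp} {c : ℝ} (hc : 0 ≤ c)
    (h : ∀ ξ : 𝒢.PreModule, ‖(T : 𝒢.HilbertMod →L[ℂ] 𝒢.HilbertMod) ξ‖ ≤ c * ‖ξ‖) :
    ‖T‖ ≤ c := by
  refine ContinuousLinearMap.opNorm_le_bound _ hc fun x => ?_
  refine UniformSpace.Completion.induction_on x (isClosed_le ?_ ?_) fun ξ => ?_
  · exact (ContinuousLinearMap.continuous _).norm
  · fun_prop
  · rw [UniformSpace.Completion.norm_coe]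
    exact h ξ

/-- On functions supported in a fixed compact set, the reduced norm is dominated by the uniform
norm. -/
theorem exists_norm_toReduced_le [LocallyCompactSpace G] {K : Set G} (hK : IsCompact K) :
    ∃ N : ℝ, 0 ≤ N ∧ ∀ (f : C_c(G, ℂ)) (c : ℝ), 0 ≤ c → (∀ γ, ‖f γ‖ ≤ c) →
      tsupport f ⊆ K → ‖𝒢.toReduced f‖ ≤ N * c := by
  -- A compactly supported cutoff equal to 1 on `K` dominates `‖f‖ / c` for every admissible `f`
  -- with `c > 0`. Hence the bound for convolution by this one function serves all of them.
  obtain ⟨k, hk1, -, hkc, hk01⟩ := exists_continuous_one_zero_of_isCompact hK isClosed_empty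
    (Set.disjoint_empty K)
  let h : C_c(G, ℂ) := ⟨⟨fun γ => (k γ : ℂ), Complex.continuous_ofReal.comp k.continuous⟩,
    hkc.comp_left (g := fun r : ℝ => (r : ℂ)) (by simp)⟩
  obtain ⟨B, hB⟩ := 𝒢.exists_bound_conv h
  refine ⟨|B|, abs_nonneg B, fun f c hc hf hs => ?_⟩
  change ‖𝒢.regRep f‖ ≤ _
  refine norm_le_of_forall_coe (by positivity) fun ξ => ?_
  rw [regRep_apply_coe, UniformSpace.Completion.norm_coe]
  have hfk : ∀ γ, ‖f γ‖ ≤ c * k γ := by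
    intro γ
    by_cases hγ : γ ∈ K
    · simpa [hk1 hγ] using hf γ
    · rw [image_eq_zero_of_notMem_tsupport fun h' => hγ (hs h'), norm_zero]
      exact mul_nonneg hc (hk01 γ).1
  calc ‖𝒢.conv f ξ‖ ≤ c * ‖𝒢.conv h ξ.abs‖ := norm_le_mul_of_pointwise hc fun γ =>
        norm_conv_apply_le (fun _ => rfl) hfk (fun γ => (hk01 γ).1) ξ γ
    _ ≤ c * (|B| * ‖ξ‖) := by
        refine mul_le_mul_of_nonneg_left ((hB _).trans ?_) hc
        exact mul_le_mul (le_abs_self B) ξ.norm_abs_le (norm_nonneg _) (abs_nonneg _)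
    _ = |B| * c * ‖ξ‖ := by ring

end RegularRepresentation

/-! ### Iterated commutators with the length operator -/

section Commutators

variable {G X : Type*} [TopologicalSpace G] [T2Space G] [TopologicalSpace X] [T2Space X]
  [CompactSpace X] {𝒢 : EtaleGroupoid G X} (ℓ : 𝒢.LengthFunction)

/-- The only unit in the source fiber of `γ` is `unit (src γ)`, where `ℓ` vanishes, so the kernel
factor `(ℓ γ - ℓ μ) ^ n` becomes `ℓ γ ^ n`. -/
theorem iteratedCommutator_one_apply (f : C_c(G, ℂ)) (n : ℕ) (γ : G) :
    𝒢.iteratedCommutator ℓ f n (PreModule.of 𝒢.one) γ = ((ℓ γ ^ n : ℝ) : ℂ) * f γ := by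
  rw [iteratedCommutator_apply, 𝒢.finsum_fiber_eq (S := {𝒢.unit (𝒢.src γ)})]
  · rw [Finset.sum_singleton, PreModule.of_apply, 𝒢.one_apply_unit, 𝒢.inv_unit, 𝒢.mul_unit,
      mul_one, (ℓ.eq_zero_iff _).mpr ⟨_, rfl⟩, sub_zero]
  · simp [𝒢.src_unit]
  · intro μ hμ h
    have : μ ∈ Set.range 𝒢.unit := by
      by_contra hn
      exact h (by rw [PreModule.of_apply, 𝒢.one_apply_of_notMem hn, mul_zero])
    obtain ⟨u, rfl⟩ := this
    rw [𝒢.src_unit] at hμ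
    simp [hμ]

/-- Evaluate `δⁿ(f)` at the vector `1`, of norm at most one, and use that the module norm dominates
point values. This is how the commutator controls `f` away from the units. -/
theorem pow_length_mul_norm_le (f : C_c(G, ℂ)) (n : ℕ) (γ : G) :
    ℓ γ ^ n * ‖f γ‖ ≤ ‖𝒢.delta ℓ n f‖ := by
  have h := norm_apply_le_norm (𝒢.iteratedCommutator ℓ f n (PreModule.of 𝒢.one)) γ
  rw [iteratedCommutator_one_apply, norm_mul, Complex.norm_real,
    Real.norm_of_nonneg (pow_nonneg (ℓ.nonneg γ) n), 
    ← UniformSpace.Completion.norm_coe (𝒢.iteratedCommutator ℓ f n (PreModule.of 𝒢.one)),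
    ← delta_apply_coe] at h
  refine h.trans ((ContinuousLinearMap.le_opNorm _ _).trans ?_)
  rw [UniformSpace.Completion.norm_coe]
  exact mul_le_of_le_one_right (norm_nonneg _) norm_one_le

theorem delta_add (n : ℕ) (f g : C_c(G, ℂ)) :
    𝒢.delta ℓ n (f + g) = 𝒢.delta ℓ n f + 𝒢.delta ℓ n g :=
  HilbertModule.adjointable_ext fun ξ => by
    change _ = (𝒢.delta ℓ n f : 𝒢.HilbertMod →L[ℂ] 𝒢.HilbertMod) ξ +
      (𝒢.delta ℓ n g : 𝒢.HilbertMod →L[ℂ] 𝒢.HilbertMod) ξ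
    rw [delta_apply_coe, delta_apply_coe, delta_apply_coe, ← UniformSpace.Completion.coe_add]
    congr 1
    refine PreModule.ext fun γ => ?_
    obtain ⟨S, h1, h2⟩ := exists_finset ξ (𝒢.src γ)
    rw [PreModule.add_apply]
    simp only [iteratedCommutator_apply, kernel_eq_sum _ ξ h1 h2, ← Finset.sum_add_distrib]
    refine Finset.sum_congr rfl fun μ _ => ?_
    rw [CompactlySupportedContinuousMap.add_apply]
    ring

theorem delta_smul (n : ℕ) (z : ℂ) (f : C_c(G, ℂ)) :
    𝒢.delta ℓ n (z • f) = z • 𝒢.delta ℓ n f :=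
  HilbertModule.adjointable_ext fun ξ => by
    change _ = z • (𝒢.delta ℓ n f : 𝒢.HilbertMod →L[ℂ] 𝒢.HilbertMod) ξ
    rw [delta_apply_coe, delta_apply_coe, ← UniformSpace.Completion.coe_smul]
    congr 1
    refine PreModule.ext fun γ => ?_
    obtain ⟨S, h1, h2⟩ := exists_finset ξ (𝒢.src γ)
    rw [PreModule.smul_apply]
    simp only [iteratedCommutator_apply, kernel_eq_sum _ ξ h1 h2, Finset.mul_sum]
    refine Finset.sum_congr rfl fun μ _ => ?_
    rw [CompactlySupportedContinuousMap.smul_apply, smul_eq_mul]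
    ring

/-- `D_ℓ` is symmetric, so taking adjoints reverses the sign of each commutator. -/
theorem delta_invol (n : ℕ) (f : C_c(G, ℂ)) :
    star (𝒢.delta ℓ n f) = (-1 : ℂ) ^ n • 𝒢.delta ℓ n (𝒢.invol f) := by
  refine HilbertModule.star_eq_of_inner fun x y => ?_
  refine UniformSpace.Completion.induction_on₂ x y (isClosed_eq ?_ ?_) fun b c => ?_
  · exact HilbertModule.continuous_inner_completion.comp
      (((ContinuousLinearMap.continuous _).comp continuous_fst).prodMk continuous_snd)
  · exact HilbertModule.continuous_inner_completion.comp
      (continuous_fst.prodMk ((ContinuousLinearMap.continuous _).comp continuous_snd))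
  · change _ = ⟪(b : 𝒢.HilbertMod),
      (-1 : ℂ) ^ n • (𝒢.delta ℓ n (𝒢.invol f) : 𝒢.HilbertMod →L[ℂ] 𝒢.HilbertMod) c⟫_C(X, ℂ)
    rw [delta_apply_coe, delta_apply_coe, ← UniformSpace.Completion.coe_smul,
      HilbertModule.inner_coe, HilbertModule.inner_coe]
    exact 𝒢.inner_iteratedCommutator ℓ f n b c

theorem norm_delta_invol (n : ℕ) (f : C_c(G, ℂ)) :
    ‖𝒢.delta ℓ n (𝒢.invol f)‖ = ‖𝒢.delta ℓ n f‖ := by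
  rw [← norm_star (𝒢.delta ℓ n f), delta_invol, norm_smul]
  simp

/-- Convolution by the unit is the identity and commutes with `D_ℓ`. At `n = 0` the claim fails in
general, since no commutator is taken and `Λ(1) = 1`. -/
theorem delta_one {n : ℕ} (hn : 1 ≤ n) : 𝒢.delta ℓ n 𝒢.one = 0 := by
  have h : ∀ n, 𝒢.iteratedCommutator ℓ 𝒢.one (n + 1) = 0 := by
    intro n
    induction n with
    | zero =>
      refine LinearMap.ext fun ξ => ?_
      change 𝒢.lengthOp ℓ (𝒢.conv 𝒢.one ξ) - 𝒢.conv 𝒢.one (𝒢.lengthOp ℓ ξ) = 0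
      rw [one_conv, one_conv, sub_self]
    | succ n ih =>
      change _ ∘ₗ 𝒢.iteratedCommutator ℓ 𝒢.one (n + 1) - 𝒢.iteratedCommutator ℓ 𝒢.one (n + 1) ∘ₗ _ = _
      rw [ih, LinearMap.comp_zero, LinearMap.zero_comp, sub_self]
  obtain ⟨m, rfl⟩ := Nat.exists_eq_add_of_le' hn
  refine HilbertModule.adjointable_ext fun ξ => ?_
  rw [delta_apply_coe, h]
  rfl

end Commutators

end EtaleGroupoid

/-! ### Lipschitz constants, sampling, and the gap of the length function at the units -/

namespace EtaleGroupoid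

section LipschitzConstant

variable {G X I : Type*} [TopologicalSpace G] [MetricSpace X] {𝒢 : EtaleGroupoid G X}
  {K : I → Set G}

theorem arrowDist_nonneg (γ μ : G) : 0 ≤ 𝒢.arrowDist γ μ := le_max_of_le_left dist_nonneg

theorem lipConst_add_le (f g : C_c(G, ℂ)) :
    𝒢.lipConst K (f + g) ≤ 𝒢.lipConst K f + 𝒢.lipConst K g := by
  refine 𝒢.lipConst_le fun i γ hγ μ hμ => ?_
  refine le_trans ?_ (add_le_add (𝒢.le_lipConst f hγ hμ) (𝒢.le_lipConst g hγ hμ))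
  rw [← ENNReal.add_div]
  refine ENNReal.div_le_div_right ?_ _
  rw [CompactlySupportedContinuousMap.add_apply, CompactlySupportedContinuousMap.add_apply,
    add_sub_add_comm]
  exact enorm_add_le _ _

theorem lipConst_smul (z : ℂ) (f : C_c(G, ℂ)) :
    𝒢.lipConst K (z • f) = ‖z‖ₑ * 𝒢.lipConst K f := by
  simp only [lipConst, ENNReal.mul_iSup, CompactlySupportedContinuousMap.smul_apply, ← smul_sub,
    enorm_smul, mul_div_assoc]

theorem norm_sub_le_arrowDist (hK : 𝒢.IsMetricStratification K) {f : C_c(G, ℂ)}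
    (hf : 𝒢.lipConst K f ≤ 1) {i : I} {γ μ : G} (hγ : γ ∈ K i) (hμ : μ ∈ K i) :
    ‖f γ - f μ‖ ≤ 𝒢.arrowDist γ μ := by
  -- At distance zero the quotient cannot be cleared of its denominator; instead the separation
  -- axiom of the stratum makes the two arrows equal.
  rcases (arrowDist_nonneg (𝒢 := 𝒢) γ μ).eq_or_lt with h0 | h0
  · rw [← h0, hK.eq_of_arrowDist_eq_zero i γ hγ μ hμ h0.symm, sub_self, norm_zero]
  · have h := (𝒢.le_lipConst f hγ hμ).trans hf
    rw [ENNReal.div_le_iff (ENNReal.ofReal_pos.mpr h0).ne' ENNReal.ofReal_ne_top, one_mul,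
      ← ofReal_norm] at h
    exact (ENNReal.ofReal_le_ofReal_iff h0.le).mp h

/-- The units are open, so removing them from the ball leaves a compact set. There `ℓ` attains its
minimum, which is positive because `ℓ` vanishes only at units. -/
theorem exists_length_lower_bound {ℓ : 𝒢.LengthFunction} (hℓ : ℓ.IsProper) {t : ℝ} (ht : 0 ≤ t) :
    ∃ c > 0, ∀ γ ∈ ℓ.ball t, γ ∉ Set.range 𝒢.unit → c ≤ ℓ γ := by
  have hc : IsCompact (ℓ.ball t \ Set.range 𝒢.unit) := (hℓ t ht).diff 𝒢.isOpen_range_unit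
  rcases (ℓ.ball t \ Set.range 𝒢.unit).eq_empty_or_nonempty with h | h
  · exact ⟨1, one_pos, fun γ hγ hγ' => ((Set.mem_empty_iff_false γ).mp (h ▸ ⟨hγ, hγ'⟩)).elim⟩
  · obtain ⟨μ, hμ, hmin⟩ := hc.exists_isMinOn h ℓ.continuous_toFun.continuousOn
    refine ⟨ℓ μ, (ℓ.nonneg μ).lt_of_ne fun h0 => hμ.2 ((ℓ.eq_zero_iff μ).mp h0.symm),
      fun γ hγ hγ' => hmin ⟨hγ, hγ'⟩⟩

/-- The strata form an open cover, so finitely many of them cover `C`, and each has a finite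
`ε`-net. The sample points lie in the strata, not necessarily in `C`. -/
theorem exists_finset_sampling (hK : 𝒢.IsMetricStratification K) {C : Set G} (hC : IsCompact C)
    {ε : ℝ} (hε : 0 < ε) :
    ∃ P : Finset G, ∀ γ ∈ C, ∃ μ ∈ P, ∃ i, γ ∈ K i ∧ μ ∈ K i ∧ 𝒢.arrowDist γ μ < ε := by
  classical
  obtain ⟨T, hT⟩ := hC.elim_finite_subcover K hK.isOpen (by rw [hK.iUnion_eq]; exact C.subset_univ)
  choose F hF hFε using fun i => hK.totallyBounded i ε hε
  refine ⟨T.biUnion F, fun γ hγ => ?_⟩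
  obtain ⟨i, hi, hγi⟩ := Set.mem_iUnion₂.mp (hT hγ)
  obtain ⟨μ, hμ, hd⟩ := hFε i γ hγi
  exact ⟨μ, Finset.mem_biUnion.mpr ⟨i, hi, hμ⟩, i, hγi, hF i hμ, hd⟩

/-- On `C`, one `ε` comes from the Lipschitz bound for `f`, one from that for `g`, and one from the
discrepancy at the sample point. Off `C` both functions vanish. -/
theorem norm_sub_le_of_sampling (hK : 𝒢.IsMetricStratification K) {C : Set G} {P : Finset G}
    {ε : ℝ} (hε : 0 < ε)
    (hP : ∀ γ ∈ C, ∃ μ ∈ P, ∃ i, γ ∈ K i ∧ μ ∈ K i ∧ 𝒢.arrowDist γ μ < ε) {f g : C_c(G, ℂ)}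
    (hf : tsupport f ⊆ C) (hg : tsupport g ⊆ C) (hfL : 𝒢.lipConst K f ≤ 1)
    (hgL : 𝒢.lipConst K g ≤ 1) (h : ∀ μ ∈ P, ‖f μ - g μ‖ ≤ ε) (γ : G) :
    ‖f γ - g γ‖ ≤ 3 * ε := by
  by_cases hγ : γ ∈ C
  · obtain ⟨μ, hμ, i, hγi, hμi, hd⟩ := hP γ hγ
    have h1 := norm_sub_le_arrowDist hK hfL hγi hμi
    have h2 := norm_sub_le_arrowDist hK hgL hγi hμi
    have h3 := h μ hμ
    have h4 : f γ - g γ = (f γ - f μ) - (g γ - g μ) + (f μ - g μ) := by ring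
    rw [h4]
    refine (norm_add_le _ _).trans ?_
    have := norm_sub_le (f γ - f μ) (g γ - g μ)
    linarith
  · rw [image_eq_zero_of_notMem_tsupport fun h => hγ (hf h),
      image_eq_zero_of_notMem_tsupport fun h => hγ (hg h), sub_zero, norm_zero]
    positivity

theorem invol_invol [T2Space G] (f : C_c(G, ℂ)) : 𝒢.invol (𝒢.invol f) = f := by
  ext γ
  rw [invol_apply, invol_apply, 𝒢.inv_inv, star_star]

/-- Inversion exchanges source and range, so it preserves `arrowDist`, and it carries strata to
strata. The inequality so obtained is an equality because the involution is its own inverse. -/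
theorem lipConst_invol [T2Space G] (hK : 𝒢.IsMetricStratification K) (f : C_c(G, ℂ)) :
    𝒢.lipConst K (𝒢.invol f) = 𝒢.lipConst K f := by
  have h : ∀ f : C_c(G, ℂ), 𝒢.lipConst K (𝒢.invol f) ≤ 𝒢.lipConst K f := by
    refine fun f => 𝒢.lipConst_le fun i γ hγ μ hμ => ?_
    obtain ⟨j, hj⟩ := hK.inv i
    refine le_trans (le_of_eq ?_) (𝒢.le_lipConst f (i := j) (hj ▸ Set.mem_image_of_mem _ hγ)
      (hj ▸ Set.mem_image_of_mem _ hμ))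
    rw [invol_apply, invol_apply, ← star_sub, arrowDist, arrowDist, 𝒢.src_inv, 𝒢.src_inv,
      𝒢.rng_inv, 𝒢.rng_inv, max_comm]
    congr 1
    simp only [enorm_eq_nnnorm, nnnorm_star]
  refine (h f).antisymm ?_
  simpa only [invol_invol] using h (𝒢.invol f)

variable [T2Space G] [CompactSpace X]

/-- The unit space is itself a stratum and the others are disjoint from it, so the indicator is
constant on every stratum. -/
theorem lipConst_one (hK : 𝒢.IsMetricStratification K) : 𝒢.lipConst K 𝒢.one = 0 := by
  refine le_antisymm (𝒢.lipConst_le fun i γ hγ μ hμ => ?_) zero_le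
  obtain ⟨e, he⟩ := hK.unit
  suffices h : 𝒢.one γ = 𝒢.one μ by simp [h]
  by_cases hi : i = e
  · subst hi
    rw [he] at hγ hμ
    obtain ⟨u, rfl⟩ := hγ
    obtain ⟨v, rfl⟩ := hμ
    rw [𝒢.one_apply_unit, 𝒢.one_apply_unit]
  · have hd := hK.disjoint i e hi
    rw [he] at hd
    rw [𝒢.one_apply_of_notMem (Set.disjoint_left.mp hd hγ),
      𝒢.one_apply_of_notMem (Set.disjoint_left.mp hd hμ)]

end LipschitzConstant

/-! ### Transfer between the operator system and its functions -/

section SubOperatorSystem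

variable {G X I : Type*} [TopologicalSpace G] [T2Space G] [MetricSpace X] [CompactSpace X]
  {𝒢 : EtaleGroupoid G X}

namespace SubOperatorSystem

variable (𝒳 : 𝒢.SubOperatorSystem)

theorem toReduced_fn (x : 𝒳.toOperatorSystem.Elem) : 𝒢.toReduced (𝒳.fn x) = x :=
  congrArg Subtype.val ((Submodule.equivMapOfInjective 𝒢.toReduced 𝒢.toReduced_injective
    𝒳.toSubmodule).apply_symm_apply x)

theorem fn_mem (x : 𝒳.toOperatorSystem.Elem) : 𝒳.fn x ∈ 𝒳.toSubmodule := Subtype.prop _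

/-- Injectivity of `toReduced` identifies the function attached to an element; the algebraic rules
for `fn` all follow from this. -/
theorem fn_eq {x : 𝒳.toOperatorSystem.Elem} {f : C_c(G, ℂ)}
    (h : (x : 𝒢.ReducedCStar) = 𝒢.toReduced f) : 𝒳.fn x = f :=
  𝒢.toReduced_injective ((𝒳.toReduced_fn x).trans h)

theorem fn_add (x y : 𝒳.toOperatorSystem.Elem) : 𝒳.fn (x + y) = 𝒳.fn x + 𝒳.fn y :=
  𝒳.fn_eq (by rw [map_add, toReduced_fn, toReduced_fn]; rfl)

theorem fn_sub (x y : 𝒳.toOperatorSystem.Elem) : 𝒳.fn (x - y) = 𝒳.fn x - 𝒳.fn y :=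
  𝒳.fn_eq (by rw [map_sub, toReduced_fn, toReduced_fn]; rfl)

theorem fn_smul (z : ℂ) (x : 𝒳.toOperatorSystem.Elem) : 𝒳.fn (z • x) = z • 𝒳.fn x :=
  𝒳.fn_eq (by rw [map_smul, toReduced_fn]; rfl)

theorem fn_adj (x : 𝒳.toOperatorSystem.Elem) :
    𝒳.fn (𝒳.toOperatorSystem.adj x) = 𝒢.invol (𝒳.fn x) :=
  𝒳.fn_eq (by rw [toReduced_invol, toReduced_fn]; rfl)

theorem fn_unit : 𝒳.fn 𝒳.toOperatorSystem.unit = 𝒢.one :=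
  𝒳.fn_eq (by rw [toReduced_one]; rfl)

end SubOperatorSystem

/-! ### The slip-norm and total boundedness of its unit ball -/

variable {K : I → Set G} {hK : 𝒢.IsMetricStratification K}

theorem isSlipNorm_totalSeminorm (ℓ : 𝒢.LengthFunction) {n : ℕ} (hn : 1 ≤ n)
    {𝒳 : 𝒢.SubOperatorSystem} (h𝒳 : 𝒳.toSubmodule ≤ (𝒢.lipSystem hK).toSubmodule) :
    OperatorSystem.IsSlipNorm fun x : 𝒳.toOperatorSystem.Elem =>
      𝒢.totalSeminorm ℓ K n (𝒳.fn x) where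
  nonneg x := le_max_of_le_left (norm_nonneg _)
  add_le x y := by
    have hx : 𝒢.lipConst K (𝒳.fn x) < ⊤ := h𝒳 (𝒳.fn_mem x)
    have hy : 𝒢.lipConst K (𝒳.fn y) < ⊤ := h𝒳 (𝒳.fn_mem y)
    rw [𝒳.fn_add]
    refine max_le ?_ ?_
    · rw [delta_add]
      exact (norm_add_le _ _).trans (add_le_add (le_max_left _ _) (le_max_left _ _))
    -- Finiteness is essential here: `toReal` sends `⊤` to `0`, so without it subadditivity could
    -- fail.
    · refine (ENNReal.toReal_mono (ENNReal.add_lt_top.mpr ⟨hx, hy⟩).ne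
        (lipConst_add_le _ _)).trans ?_
      rw [ENNReal.toReal_add hx.ne hy.ne]
      exact add_le_add (le_max_right _ _) (le_max_right _ _)
  smul z x := by
    rw [𝒳.fn_smul, totalSeminorm, totalSeminorm, delta_smul, norm_smul, lipConst_smul,
      ENNReal.toReal_mul, toReal_enorm, mul_max_of_nonneg _ _ (norm_nonneg z)]
  adj x := by
    rw [𝒳.fn_adj, totalSeminorm, totalSeminorm, norm_delta_invol, lipConst_invol hK]
  scalar z := by
    rw [𝒳.fn_smul, 𝒳.fn_unit, totalSeminorm, delta_smul, lipConst_smul, delta_one ℓ hn,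
      lipConst_one hK]
    simp

/-- The normalisation at `u` removes the scalars. Units are then bounded through the Lipschitz
condition on their common stratum, and other arrows of the ball through the commutator. -/
theorem exists_uniform_bound {ℓ : 𝒢.LengthFunction} (hℓ : ℓ.IsProper)
    (hK : 𝒢.IsMetricStratification K) {t : ℝ} (ht : 0 ≤ t) (n : ℕ) (u : X) :
    ∃ R : ℝ, ∀ f : C_c(G, ℂ), tsupport f ⊆ ℓ.ball t → ‖𝒢.delta ℓ n f‖ ≤ 1 →
      𝒢.lipConst K f ≤ 1 → f (𝒢.unit u) = 0 → ∀ γ, ‖f γ‖ ≤ R := by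
  obtain ⟨c, hc, hcℓ⟩ := exists_length_lower_bound hℓ ht
  -- The diameter, finite by compactness of `X`, bounds `f` on units; `(c ^ n)⁻¹` bounds it on the
  -- other arrows of the ball.
  refine ⟨max (Metric.diam (Set.univ : Set X)) (c ^ n)⁻¹, fun f hs hd hL hu γ => ?_⟩
  by_cases hγ : γ ∈ ℓ.ball t
  · by_cases hγu : γ ∈ Set.range 𝒢.unit
    · obtain ⟨v, rfl⟩ := hγu
      obtain ⟨e, he⟩ := hK.unit
      have h := norm_sub_le_arrowDist hK hL (he ▸ Set.mem_range_self v : 𝒢.unit v ∈ K e)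
        (he ▸ Set.mem_range_self u : 𝒢.unit u ∈ K e)
      rw [hu, sub_zero, arrowDist, 𝒢.src_unit, 𝒢.src_unit, 𝒢.rng_unit, 𝒢.rng_unit, max_self] at h
      exact le_max_of_le_left (h.trans (Metric.dist_le_diam_of_mem isCompact_univ.isBounded
        (Set.mem_univ _) (Set.mem_univ _)))
    · refine le_max_of_le_right ?_
      have h : c ^ n * ‖f γ‖ ≤ 1 := by
        refine le_trans ?_ ((pow_length_mul_norm_le ℓ f n γ).trans hd)
        gcongr
        exact hcℓ γ hγ hγu
      rwa [← one_div, le_div_iff₀ (by positivity), mul_comm]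
  · rw [image_eq_zero_of_notMem_tsupport fun h => hγ (hs h), norm_zero]
    exact le_max_of_le_left Metric.diam_nonneg

theorem exists_finite_net [LocallyCompactSpace G] {ℓ : 𝒢.LengthFunction} (hℓ : ℓ.IsProper)
    {n : ℕ} (hn : 1 ≤ n) {𝒳 : 𝒢.SubOperatorSystem}
    (h𝒳 : 𝒳.toSubmodule ≤ (𝒢.lipSystem hK).toSubmodule) {t : ℝ} (ht : 0 ≤ t)
    (hs : ∀ f ∈ 𝒳.toSubmodule, tsupport f ⊆ ℓ.ball t) {ε : ℝ} (hε : 0 < ε) :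
    ∃ F : Set 𝒳.toOperatorSystem.Elem, F.Finite ∧
      ∀ x, 𝒢.totalSeminorm ℓ K n (𝒳.fn x) ≤ 1 →
        ∃ y ∈ F, ∃ z : ℂ, ‖x - z • 𝒳.toOperatorSystem.unit - y‖ < ε := by
  have hnorm : ∀ x : 𝒳.toOperatorSystem.Elem, ‖x‖ = ‖𝒢.toReduced (𝒳.fn x)‖ := fun x => by
    rw [𝒳.toReduced_fn]
    rfl
  -- Without a unit to normalise at, there are no arrows either and everything is zero.
  rcases isEmpty_or_nonempty X with hX | ⟨⟨u⟩⟩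
  · refine ⟨{0}, Set.finite_singleton 0, fun x _ => ⟨0, rfl, 0, ?_⟩⟩
    have h0 : 𝒳.fn x = 0 := by
      ext γ
      exact isEmptyElim (𝒢.src γ)
    rw [zero_smul, sub_zero, sub_zero, hnorm, h0, map_zero, norm_zero]
    exact hε
  have hlip : ∀ x, 𝒢.totalSeminorm ℓ K n (𝒳.fn x) ≤ 1 → 𝒢.lipConst K (𝒳.fn x) ≤ 1 := by
    intro x hx
    have hfin : 𝒢.lipConst K (𝒳.fn x) < ⊤ := h𝒳 (𝒳.fn_mem x)
    rw [← ENNReal.toReal_le_toReal hfin.ne ENNReal.one_ne_top, ENNReal.toReal_one]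
    exact (le_max_right _ _).trans hx
  obtain ⟨N, hN0, hN⟩ := exists_norm_toReduced_le (𝒢 := 𝒢) (hℓ t ht)
  obtain ⟨R, hR⟩ := exists_uniform_bound hℓ hK ht n u
  -- The final error is `N * (3 * η)`, which this choice keeps below `ε`; the `+ 1` covers `N = 0`.
  set η := ε / (4 * (N + 1)) with hη
  have hη0 : 0 < η := by positivity
  obtain ⟨P, hP⟩ := exists_finset_sampling hK (hℓ t ht) hη0
  let S : Set 𝒳.toOperatorSystem.Elem :=
    {x | 𝒢.totalSeminorm ℓ K n (𝒳.fn x) ≤ 1 ∧ 𝒳.fn x (𝒢.unit u) = 0}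
  let ev : 𝒳.toOperatorSystem.Elem → P → ℂ := fun x μ => 𝒳.fn x μ
  -- The sample vectors form a bounded set in the finite-dimensional space `P → ℂ`.
  have hev : TotallyBounded (ev '' S) := by
    refine (isCompact_closedBall (0 : P → ℂ) |R|).totallyBounded.subset ?_
    rintro _ ⟨x, ⟨hx, hxu⟩, rfl⟩
    rw [mem_closedBall_zero_iff, pi_norm_le_iff_of_nonneg (abs_nonneg R)]
    exact fun μ => (hR _ (hs _ (𝒳.fn_mem x)) ((le_max_left _ _).trans hx) (hlip x hx) hxu μ).trans
      (le_abs_self R)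
  -- The centres of the net are sample vectors of elements of `S` itself, so they inherit the
  -- Lipschitz bound needed for the comparison by sampling.
  obtain ⟨F, hFS, hF, hcov⟩ := Set.exists_subset_image_finite_and.mp
    (Metric.finite_approx_of_totallyBounded hev η hη0)
  refine ⟨F, hF, fun x hx => ?_⟩
  have hL := isSlipNorm_totalSeminorm ℓ hn h𝒳
  set z := 𝒳.fn x (𝒢.unit u)
  set x' := x - z • 𝒳.toOperatorSystem.unit with hx'
  have hx'S : x' ∈ S := by
    refine ⟨?_, ?_⟩
    -- Subtracting a scalar does not increase the slip-norm, which vanishes on scalars.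
    · have h1 := hL.add_le x (-z • 𝒳.toOperatorSystem.unit)
      rw [hL.scalar, add_zero, neg_smul, ← sub_eq_add_neg] at h1
      exact h1.trans hx
    · rw [hx', 𝒳.fn_sub, 𝒳.fn_smul, 𝒳.fn_unit, CompactlySupportedContinuousMap.sub_apply,
        CompactlySupportedContinuousMap.smul_apply, one_apply_unit, smul_eq_mul, mul_one, sub_self]
  obtain ⟨_, himg, hxy⟩ := Set.mem_iUnion₂.mp (hcov (Set.mem_image_of_mem ev hx'S))
  obtain ⟨y, hy, rfl⟩ := himg
  refine ⟨y, hy, z, ?_⟩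
  have hpt : ∀ γ, ‖𝒳.fn (x' - y) γ‖ ≤ 3 * η := by
    intro γ
    rw [𝒳.fn_sub, CompactlySupportedContinuousMap.sub_apply]
    refine norm_sub_le_of_sampling hK hη0 hP (hs _ (𝒳.fn_mem x')) (hs _ (𝒳.fn_mem y))
      (hlip _ hx'S.1) (hlip _ (hFS hy).1) (fun μ hμ => ?_) γ
    have h1 := (dist_le_pi_dist (ev x') (ev y) ⟨μ, hμ⟩).trans (Metric.mem_ball.mp hxy).le
    rwa [dist_eq_norm] at h1
  rw [hnorm]
  -- Since `𝒳` is a subspace, the function of the difference is again supported in the ball, so the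
  -- reduced norm estimate applies to it.
  refine (hN _ (3 * η) (by positivity) hpt (hs _ (𝒳.fn_mem _))).trans_lt ?_
  rw [hη, show N * (3 * (ε / (4 * (N + 1)))) = 3 * N * ε / (4 * (N + 1)) by ring,
    div_lt_iff₀ (by positivity)]
  nlinarith

end SubOperatorSystem

end EtaleGroupoid

/-! ### The main result -/

theorem lemma3p9 {G X I : Type*} [TopologicalSpace G] [T2Space G] [LocallyCompactSpace G]
    [SecondCountableTopology G] [MetricSpace X] [CompactSpace X] (𝒢 : EtaleGroupoid G X)
    (ℓ : 𝒢.LengthFunction) (hℓ : ℓ.IsProper) (K : I → Set G) (hK : 𝒢.IsMetricStratification K)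
    (n : ℕ) (hn : 1 ≤ n) :
    (∀ 𝒳 : 𝒢.SubOperatorSystem, 𝒳.toSubmodule ≤ (𝒢.lipSystem hK).toSubmodule →
      (∃ t : ℝ, 0 ≤ t ∧ ∀ f ∈ 𝒳.toSubmodule, tsupport f ⊆ ℓ.ball t) →
      𝒳.IsCompactQuantumMetricSpace (𝒢.totalSeminorm ℓ K n)) ∧
    (CompactSpace G →
      (𝒢.lipSystem hK).IsCompactQuantumMetricSpace (𝒢.totalSeminorm ℓ K n)) := by
  have main : ∀ 𝒳 : 𝒢.SubOperatorSystem, 𝒳.toSubmodule ≤ (𝒢.lipSystem hK).toSubmodule →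
      (∃ t : ℝ, 0 ≤ t ∧ ∀ f ∈ 𝒳.toSubmodule, tsupport f ⊆ ℓ.ball t) →
      𝒳.IsCompactQuantumMetricSpace (𝒢.totalSeminorm ℓ K n) := by
    rintro 𝒳 h𝒳 ⟨t, ht, hs⟩
    exact (EtaleGroupoid.isSlipNorm_totalSeminorm ℓ hn h𝒳).isCompactQuantumMetricSpace
      fun ε hε => EtaleGroupoid.exists_finite_net hℓ hn h𝒳 ht hs hε
  refine ⟨main, fun hG => main _ le_rfl ?_⟩
  -- On a compact groupoid `ℓ` is bounded, so a single ball contains every arrow and the support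
  -- condition is automatic.
  obtain ⟨t, ht⟩ := isCompact_univ.exists_bound_of_continuousOn ℓ.continuous_toFun.continuousOn
  refine ⟨|t|, abs_nonneg t, fun f _ γ _ => ?_⟩
  exact (le_abs_self _).trans ((ht γ (Set.mem_univ γ)).trans (le_abs_self t))
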